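/- Let $\mathbf F$ be an algebraically closed field of characteristic $p>3$, let $\Gamma$ be a finite abelian group and let $(\cdot,\cdot):\Gamma\times\Gamma\to\mathbf F^\times$ be a bicharacter, i.e. $(\alpha,\beta)(\beta,\alpha)=1$, $(\alpha,\beta+\gamma)=(\alpha,\beta)(\alpha,\gamma)$ and $(\alpha+\beta,\gamma)=(\alpha,\gamma)(\beta,\gamma)$. Let $V$ be a $\Gamma$-graded $\mathbf F$-vector space with an ordered basis $v_1,\dots,v_m$ of homogeneous vectors, $v_i$ of degree $d_i\in\Gamma$, and let $\mathfrak g=\mathrm{gl}(m,\Gamma)=\mathrm{gl}(V)$, which we identify with the $m\times m$ matrices; the matrix unit $e_{ij}$ has degree $d_i-d_j$. It is a restricted Lie color algebra with $[x,y]=xy-(\alpha,\beta)yx$ for $x\in\mathfrak g_\alpha$, $y\in\mathfrak g_\beta$, and $x^{[p]}=x^p$ for $x\in\mathfrak g_\alpha$ with $(\alpha,\alpha)=1$. Put $H=\sum_i\mathbf Fe_{ii}$, $N^+=\sum_{i<j}\mathbf Fe_{ij}$, $N^-=\sum_{i>j}\mathbf Fe_{ij}$ and $B=H\oplus N^+$.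 For the positive root $\delta=\epsilon_i-\epsilon_j$, $i<j$, put $H_\delta=e_{ii}-e_{jj}$ if $(d_i-d_j,d_i-d_j)=1$, and $H_\delta=e_{ii}+e_{jj}$ otherwise. Let $\chi\in\mathfrak g^*$ vanish on $\mathfrak g_\alpha$ for all $\alpha\ne 0$ and satisfy $\chi(N^+)=\chi(N^-)=0$. For $\mathfrak s=\mathfrak g$ or $\mathfrak s=B$, let $u_\chi(\mathfrak s)$ be the quotient of the universal enveloping algebra $U(\mathfrak s)$ (the tensor algebra of $\mathfrak s$ modulo the relations $x\otimes y-(\alpha,\beta)\,y\otimes x=[x,y]$ for $x\in\mathfrak s_\alpha$, $y\in\mathfrak s_\beta$) by the two-sided ideal generated by all $x^p-x^{[p]}-\chi(x)^p\cdot 1$ with $x\in\mathfrak s_\alpha$, $(\alpha,\alpha)=1$. Let $\lambda\in H^*$ satisfy $\lambda(h)^p-\lambda(h^{[p]})=\chi(h)^p$ for all $h\in H$, so that the one-dimensional space $\mathbf Fv$, with $v$ homogeneous, becomes a $u_\chi(B)$-module through $N^+v=0$ and $hv=\lambda(h)v$ for $h\in H$. The $\Gamma$-graded $u_\chi(\mathfrak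 g)$-module $$Z^\chi(\lambda)=u_\chi(\mathfrak g)\otimes_{u_\chi(B)}\mathbf Fv$$ is called a baby Verma module. If $\chi$ is regular semisimple, that is, if moreover $\chi(H_\delta)\neq 0$ for every positive root $\delta$, then every baby Verma module $Z^\chi(\lambda)$ is simple: it is nonzero, and its only $\Gamma$-graded submodules are $0$ and $Z^\chi(\lambda)$. -/

import Mathlib

open scoped TensorProduct

noncomputable section

namespace ColorLie

/-- A bicharacter on the abelian group `Γ` with values in `Fˣ`. -/
structure Bicharacter (F : Type*) [Field F] (Γ : Type*) [AddCommGroup Γ] where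
  toFun : Γ → Γ → Fˣ
  mul_swap : ∀ α β, toFun α β * toFun β α = 1
  map_add_right : ∀ α β γ, toFun α (β + γ) = toFun α β * toFun α γ
  map_add_left : ∀ α β γ, toFun (α + β) γ = toFun α γ * toFun β γ

variable {F : Type*} [Field F] {Γ : Type*} [AddCommGroup Γ] {m : ℕ}

/-- The value `(α, β)` as an element of the field. -/
def Bicharacter.val (ε : Bicharacter F Γ) (α β : Γ) : F := (ε.toFun α β : F)

/-- `γ` belongs to `Γ⁺`, that is, `(γ, γ) = 1`. -/
def Bicharacter.IsEven (ε : Bicharacter F Γ) (γ : Γ) : Prop := ε.val γ γ = 1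

theorem Bicharacter.val_zero_left (ε : Bicharacter F Γ) (β : Γ) : ε.val 0 β = 1 := by
  have h := ε.map_add_left 0 0 β
  simp only [add_zero] at h
  have h2 : ε.toFun 0 β = 1 := by simpa using h
  simp [Bicharacter.val, h2]

/-! ### The general linear Lie color algebra

`V` has the ordered homogeneous basis `v_1, …, v_m`, where `v_i` has degree `d i`. The algebra
`gl(m, Γ) = gl(V)` is identified with the matrix algebra by means of this basis; the matrix unit
`e_ij` sends `v_j` to `v_i` and has degree `d i - d j`. -/

/-- The homogeneous component `gl(m, Γ)_α`: the endomorphisms that map `V_γ` to `V_{γ + α}`. -/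
def glGr (d : Fin m → Γ) (α : Γ) : Submodule F (Matrix (Fin m) (Fin m) F) where
  carrier := {x | ∀ i j, x i j ≠ 0 → d i = d j + α}
  add_mem' := by
    intro x y hx hy i j h
    by_cases h1 : x i j = 0
    · exact hy i j (by intro h2; exact h (by simp [h1, h2]))
    · exact hx i j h1
  zero_mem' := by intro i j h; simp at h
  smul_mem' := by
    intro c x hx i j h
    exact hx i j (by intro h2; exact h (by simp [h2]))

open Classical in
/-- The component of degree `α` of a matrix. -/
def glComponent (d : Fin m → Γ) (α : Γ) (x : Matrix (Fin m) (Fin m) F) :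
    Matrix (Fin m) (Fin m) F :=
  Matrix.of fun i j => if d i = d j + α then x i j else 0

/-- The color bracket `[x, y] = xy - (α, β) yx` of `x` of degree `α` and `y` of degree `β`. -/
def colorBracket (ε : Bicharacter F Γ) (α β : Γ) (x y : Matrix (Fin m) (Fin m) F) :
    Matrix (Fin m) (Fin m) F :=
  x * y - ε.val α β • (y * x)

/-- A restricted Lie color subalgebra of `gl(m, Γ)`: a graded subspace closed under the color
bracket and under the `p`-map `x ↦ x ^ p` on homogeneous elements of even degree. -/
structure RestrictedSubalgebra (ε : Bicharacter F Γ) (d : Fin m → Γ) (p : ℕ) where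
  carrier : Submodule F (Matrix (Fin m) (Fin m) F)
  component_mem : ∀ (α : Γ) (x : Matrix (Fin m) (Fin m) F),
    x ∈ carrier → glComponent d α x ∈ carrier
  bracket_mem : ∀ (α β : Γ) (x y : Matrix (Fin m) (Fin m) F),
    x ∈ carrier → y ∈ carrier → x ∈ glGr d α → y ∈ glGr d β →
      colorBracket ε α β x y ∈ carrier
  pow_mem : ∀ (α : Γ) (x : Matrix (Fin m) (Fin m) F),
    ε.IsEven α → x ∈ carrier → x ∈ glGr d α → x ^ p ∈ carrier

/-- `gl(m, Γ)` itself. -/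
def gl (ε : Bicharacter F Γ) (d : Fin m → Γ) (p : ℕ) : RestrictedSubalgebra ε d p where
  carrier := ⊤
  component_mem := by intros; trivial
  bracket_mem := by intros; trivial
  pow_mem := by intros; trivial

/-- The subspace `H ⊕ N⁺` of upper triangular matrices. -/
def upperTriangular (F : Type*) [Field F] (m : ℕ) :
    Submodule F (Matrix (Fin m) (Fin m) F) where
  carrier := {x | ∀ i j, j < i → x i j = 0}
  add_mem' := by intro x y hx hy i j h; simp [hx i j h, hy i j h]
  zero_mem' := by intro i j _; rfl
  smul_mem' := by intro c x hx i j h; simp [hx i j h]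

theorem upperTriangular_mul {x y : Matrix (Fin m) (Fin m) F}
    (hx : x ∈ upperTriangular F m) (hy : y ∈ upperTriangular F m) :
    x * y ∈ upperTriangular F m := by
  intro i j hij
  rw [Matrix.mul_apply]
  refine Finset.sum_eq_zero fun k _ => ?_
  rcases lt_or_ge k i with h | h
  · rw [hx i k h, zero_mul]
  · rw [hy k j (lt_of_lt_of_le hij h), mul_zero]

theorem upperTriangular_one : (1 : Matrix (Fin m) (Fin m) F) ∈ upperTriangular F m := by
  intro i j hij
  exact Matrix.one_apply_ne (ne_of_gt hij)

theorem upperTriangular_pow {x : Matrix (Fin m) (Fin m) F}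
    (hx : x ∈ upperTriangular F m) (n : ℕ) : x ^ n ∈ upperTriangular F m := by
  induction n with
  | zero => rw [pow_zero]; exact upperTriangular_one
  | succ n ih => rw [pow_succ]; exact upperTriangular_mul ih hx

theorem diag_mul_of_upperTriangular {x y : Matrix (Fin m) (Fin m) F}
    (hx : x ∈ upperTriangular F m) (hy : y ∈ upperTriangular F m) :
    (x * y).diag = x.diag * y.diag := by
  funext i
  rw [Matrix.diag_apply, Matrix.mul_apply, Finset.sum_eq_single i]
  · rfl
  · intro k _ hk
    rcases lt_or_gt_of_ne hk with h | h
    · rw [hx i k h, zero_mul]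
    · rw [hy k i h, mul_zero]
  · intro h; exact absurd (Finset.mem_univ i) h

theorem diag_pow_of_upperTriangular {x : Matrix (Fin m) (Fin m) F}
    (hx : x ∈ upperTriangular F m) (n : ℕ) : (x ^ n).diag = x.diag ^ n := by
  induction n with
  | zero => rw [pow_zero, pow_zero, Matrix.diag_one]
  | succ n ih =>
    rw [pow_succ, pow_succ, diag_mul_of_upperTriangular (upperTriangular_pow hx n) hx, ih]

theorem diag_eq_zero_of_mem_glGr {d : Fin m → Γ} {α : Γ} (hα : α ≠ 0)
    {x : Matrix (Fin m) (Fin m) F} (hx : x ∈ glGr d α) : x.diag = 0 := by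
  funext i
  by_contra h
  exact hα (by simpa using hx i i h)

/-- The Borel subalgebra `B = H ⊕ N⁺`. -/
def borel (ε : Bicharacter F Γ) (d : Fin m → Γ) (p : ℕ) : RestrictedSubalgebra ε d p where
  carrier := upperTriangular F m
  component_mem := by
    intro α x hx i j hij
    simp [glComponent, hx i j hij]
  bracket_mem := fun _ _ _ _ hx hy _ _ =>
    Submodule.sub_mem _ (upperTriangular_mul hx hy)
      (Submodule.smul_mem _ _ (upperTriangular_mul hy hx))
  pow_mem := fun _ _ _ hx _ => upperTriangular_pow hx p

/-! ### Enveloping algebras -/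

section Enveloping

variable {ε : Bicharacter F Γ} {d : Fin m → Γ} {p : ℕ}

/-- The relations `x ⊗ y - (α, β) y ⊗ x = [x, y]` in the tensor algebra. -/
inductive EnvRel (S : RestrictedSubalgebra ε d p) :
    TensorAlgebra F S.carrier → TensorAlgebra F S.carrier → Prop
  | bracket (α β : Γ) (x y : S.carrier) (hx : x.1 ∈ glGr d α) (hy : y.1 ∈ glGr d β) :
      EnvRel S
        (TensorAlgebra.ι F x * TensorAlgebra.ι F y
          - ε.val α β • (TensorAlgebra.ι F y * TensorAlgebra.ι F x))
        (TensorAlgebra.ι F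
          ⟨colorBracket ε α β x.1 y.1, S.bracket_mem α β x.1 y.1 x.2 y.2 hx hy⟩)

/-- The universal enveloping algebra `U(S)`. -/
def Env (S : RestrictedSubalgebra ε d p) : Type _ := RingQuot (EnvRel S)

instance (S : RestrictedSubalgebra ε d p) : Ring (Env S) :=
  inferInstanceAs (Ring (RingQuot (EnvRel S)))

instance (S : RestrictedSubalgebra ε d p) : Algebra F (Env S) :=
  inferInstanceAs (Algebra F (RingQuot (EnvRel S)))

/-- The canonical map `S → U(S)`. -/
def envι (S : RestrictedSubalgebra ε d p) : S.carrier →ₗ[F] Env S :=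
  (RingQuot.mkAlgHom F (EnvRel S)).toLinearMap ∘ₗ TensorAlgebra.ι F

/-- The relations `x ^ p - x^[p] = χ(x) ^ p`, for `x` homogeneous of even degree. -/
inductive RedRel (S : RestrictedSubalgebra ε d p)
    (χ : Module.Dual F (Matrix (Fin m) (Fin m) F)) : Env S → Env S → Prop
  | pchar (α : Γ) (x : S.carrier) (hα : ε.IsEven α) (hx : x.1 ∈ glGr d α) :
      RedRel S χ
        (envι S x ^ p - envι S ⟨x.1 ^ p, S.pow_mem α x.1 hα x.2 hx⟩)
        (algebraMap F (Env S) (χ x.1 ^ p))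

/-- The `χ`-reduced enveloping algebra `u_χ(S) = U(S) / I_χ`, where `χ` is a linear function on
`gl(m, Γ)` (restricted to `S`) that vanishes on all components of nonzero degree. -/
def RedEnv (S : RestrictedSubalgebra ε d p)
    (χ : Module.Dual F (Matrix (Fin m) (Fin m) F)) : Type _ := RingQuot (RedRel S χ)

variable (S : RestrictedSubalgebra ε d p) (χ : Module.Dual F (Matrix (Fin m) (Fin m) F))

instance : Ring (RedEnv S χ) := inferInstanceAs (Ring (RingQuot (RedRel S χ)))

instance : Algebra F (RedEnv S χ) := inferInstanceAs (Algebra F (RingQuot (RedRel S χ)))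

/-- The canonical map `σ : S → u_χ(S)`. -/
def redι : S.carrier →ₗ[F] RedEnv S χ :=
  (RingQuot.mkAlgHom F (RedRel S χ)).toLinearMap ∘ₗ envι S

theorem envι_bracket (α β : Γ) (x y : S.carrier) (hx : x.1 ∈ glGr d α) (hy : y.1 ∈ glGr d β) :
    envι S x * envι S y - ε.val α β • (envι S y * envι S x)
      = envι S ⟨colorBracket ε α β x.1 y.1, S.bracket_mem α β x.1 y.1 x.2 y.2 hx hy⟩ := by
  have h := RingQuot.mkAlgHom_rel F (EnvRel.bracket α β x y hx hy)
  rw [map_sub, map_smul, map_mul, map_mul] at h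
  exact h

theorem redι_bracket (α β : Γ) (x y : S.carrier) (hx : x.1 ∈ glGr d α) (hy : y.1 ∈ glGr d β) :
    redι S χ x * redι S χ y - ε.val α β • (redι S χ y * redι S χ x)
      = redι S χ ⟨colorBracket ε α β x.1 y.1, S.bracket_mem α β x.1 y.1 x.2 y.2 hx hy⟩ := by
  have h := congrArg (RingQuot.mkAlgHom F (RedRel S χ)) (envι_bracket S α β x y hx hy)
  rw [map_sub, map_smul, map_mul, map_mul] at h
  exact h

theorem redι_pow (α : Γ) (x : S.carrier) (hα : ε.IsEven α) (hx : x.1 ∈ glGr d α) :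
    redι S χ x ^ p - redι S χ ⟨x.1 ^ p, S.pow_mem α x.1 hα x.2 hx⟩
      = algebraMap F (RedEnv S χ) (χ x.1 ^ p) := by
  have h := RingQuot.mkAlgHom_rel F (RedRel.pchar (χ := χ) α x hα hx)
  rw [map_sub, map_pow, AlgHom.commutes] at h
  exact h

/-- The universal property of `U(S)`, for ungraded algebras. -/
def envLift {A : Type*} [Ring A] [Algebra F A] (g : S.carrier →ₗ[F] A)
    (hbr : ∀ (α β : Γ) (x y : S.carrier) (hx : x.1 ∈ glGr d α) (hy : y.1 ∈ glGr d β),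
      g x * g y - ε.val α β • (g y * g x)
        = g ⟨colorBracket ε α β x.1 y.1, S.bracket_mem α β x.1 y.1 x.2 y.2 hx hy⟩) :
    Env S →ₐ[F] A :=
  RingQuot.liftAlgHom F ⟨TensorAlgebra.lift F g, by
    rintro _ _ ⟨α, β, x, y, hx, hy⟩
    rw [map_sub, map_smul, map_mul, map_mul]
    simp only [TensorAlgebra.lift_ι_apply]
    exact hbr α β x y hx hy⟩

theorem envLift_ι {A : Type*} [Ring A] [Algebra F A] (g : S.carrier →ₗ[F] A)
    (hbr : ∀ (α β : Γ) (x y : S.carrier) (hx : x.1 ∈ glGr d α) (hy : y.1 ∈ glGr d β),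
      g x * g y - ε.val α β • (g y * g x)
        = g ⟨colorBracket ε α β x.1 y.1, S.bracket_mem α β x.1 y.1 x.2 y.2 hx hy⟩)
    (x : S.carrier) : envLift S g hbr (envι S x) = g x := by
  refine (RingQuot.liftAlgHom_mkAlgHom_apply F _ _ _).trans ?_
  exact TensorAlgebra.lift_ι_apply g x

/-- The universal property of `u_χ(S)`, for ungraded algebras. -/
def redLift {A : Type*} [Ring A] [Algebra F A] (g : S.carrier →ₗ[F] A)
    (hbr : ∀ (α β : Γ) (x y : S.carrier) (hx : x.1 ∈ glGr d α) (hy : y.1 ∈ glGr d β),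
      g x * g y - ε.val α β • (g y * g x)
        = g ⟨colorBracket ε α β x.1 y.1, S.bracket_mem α β x.1 y.1 x.2 y.2 hx hy⟩)
    (hpow : ∀ (α : Γ) (x : S.carrier) (hα : ε.IsEven α) (hx : x.1 ∈ glGr d α),
      g x ^ p - g ⟨x.1 ^ p, S.pow_mem α x.1 hα x.2 hx⟩ = algebraMap F A (χ x.1 ^ p)) :
    RedEnv S χ →ₐ[F] A :=
  RingQuot.liftAlgHom F ⟨envLift S g hbr, by
    rintro _ _ ⟨α, x, hα, hx⟩
    rw [map_sub, map_pow, AlgHom.commutes, envLift_ι, envLift_ι]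
    exact hpow α x hα hx⟩

theorem redLift_ι {A : Type*} [Ring A] [Algebra F A] (g : S.carrier →ₗ[F] A)
    (hbr : ∀ (α β : Γ) (x y : S.carrier) (hx : x.1 ∈ glGr d α) (hy : y.1 ∈ glGr d β),
      g x * g y - ε.val α β • (g y * g x)
        = g ⟨colorBracket ε α β x.1 y.1, S.bracket_mem α β x.1 y.1 x.2 y.2 hx hy⟩)
    (hpow : ∀ (α : Γ) (x : S.carrier) (hα : ε.IsEven α) (hx : x.1 ∈ glGr d α),
      g x ^ p - g ⟨x.1 ^ p, S.pow_mem α x.1 hα x.2 hx⟩ = algebraMap F A (χ x.1 ^ p))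
    (x : S.carrier) : redLift S χ g hbr hpow (redι S χ x) = g x := by
  refine (RingQuot.liftAlgHom_mkAlgHom_apply F _ _ _).trans ?_
  exact envLift_ι S g hbr x

/-- `IsMonomial S χ α w`: `w` is a product `σ(x₁) ⋯ σ(x_k)` with `x_i` homogeneous, the degrees
of the `x_i` adding up to `α`. -/
inductive IsMonomial : Γ → RedEnv S χ → Prop
  | one : IsMonomial 0 1
  | cons (α β : Γ) (x : S.carrier) (w : RedEnv S χ) (hx : x.1 ∈ glGr d α)
      (hw : IsMonomial β w) : IsMonomial (α + β) (redι S χ x * w)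

/-- The component of degree `α` of the `Γ`-graded algebra `u_χ(S)`. -/
def redGr (α : Γ) : Submodule F (RedEnv S χ) := Submodule.span F {w | IsMonomial S χ α w}

theorem le_gl : S.carrier ≤ (gl ε d p).carrier := fun _ _ => trivial

/-- The canonical homomorphism `u_χ(S) → u_χ(gl(m, Γ))`. -/
def redIncl : RedEnv S χ →ₐ[F] RedEnv (gl ε d p) χ :=
  redLift S χ (redι (gl ε d p) χ ∘ₗ Submodule.inclusion (le_gl S))
    (by
      intro α β x y hx hy
      exact redι_bracket (gl ε d p) χ α β ⟨x.1, trivial⟩ ⟨y.1, trivial⟩ hx hy)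
    (by
      intro α x hα hx
      exact redι_pow (gl ε d p) χ α ⟨x.1, trivial⟩ hα hx)

theorem redIncl_ι (x : S.carrier) :
    redIncl S χ (redι S χ x) = redι (gl ε d p) χ ⟨x.1, le_gl S x.2⟩ :=
  redLift_ι S χ (redι (gl ε d p) χ ∘ₗ Submodule.inclusion (le_gl S)) _ _ x

end Enveloping

/-! ### Induced modules -/

section Induced

variable {A B : Type*} [Ring A] [Algebra F A] [Ring B] [Algebra F B]
  {M : Type*} [AddCommGroup M] [Module F M]

/-- The relations `aφ(b) ⊗ m = a ⊗ bm` that define `A ⊗_B M` as a quotient of `A ⊗_F M`, where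
`A` is a right `B`-module through `φ` and `M` is a left `B`-module through `ρ`. -/
def inducedRel (φ : B →ₐ[F] A) (ρ : B →ₐ[F] Module.End F M) : Submodule A (A ⊗[F] M) :=
  Submodule.span A
    {t | ∃ (a : A) (b : B) (v : M), t = (a * φ b) ⊗ₜ[F] v - a ⊗ₜ[F] (ρ b v)}

/-- The induced module `A ⊗_B M`. -/
abbrev Induced (φ : B →ₐ[F] A) (ρ : B →ₐ[F] Module.End F M) : Type _ :=
  (A ⊗[F] M) ⧸ inducedRel φ ρ

/-- The element `a ⊗ v` of `A ⊗_B M`. -/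
def Induced.tmul (φ : B →ₐ[F] A) (ρ : B →ₐ[F] Module.End F M) (a : A) (v : M) : Induced φ ρ :=
  Submodule.Quotient.mk (a ⊗ₜ[F] v)

/-- The component of degree `α` of `A ⊗_B M`, spanned by the `a ⊗ v` with `a` and `v` homogeneous
of degrees adding up to `α`. -/
def Induced.gr (φ : B →ₐ[F] A) (ρ : B →ₐ[F] Module.End F M) (grA : Γ → Submodule F A)
    (grM : Γ → Submodule F M) (α : Γ) : Submodule F (Induced φ ρ) :=
  Submodule.span F
    {t | ∃ (β γ : Γ) (a : A) (v : M), β + γ = α ∧ a ∈ grA β ∧ v ∈ grM γ ∧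
      t = Induced.tmul φ ρ a v}

/-- A `Γ`-graded `A`-module is simple if it is nonzero and has no `A`-submodules that are graded
(that is, are the sum of their intersections with the components) except `0` and itself. -/
def IsGradedSimple (A : Type*) [Ring A] [Algebra F A] {Z : Type*} [AddCommGroup Z] [Module A Z]
    [Module F Z] [IsScalarTower F A Z] (grZ : Γ → Submodule F Z) : Prop :=
  Nontrivial Z ∧ ∀ N : Submodule A Z,
    N.restrictScalars F = ⨆ α, N.restrictScalars F ⊓ grZ α → N = ⊥ ∨ N = ⊤

end Induced

/-! ### Baby Verma modules -/

section BabyVerma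

variable (ε : Bicharacter F Γ) (d : Fin m → Γ)

/-- `χ ∈ g*_0`: the linear function vanishes on all components of nonzero degree. -/
def IsDegreeZero (χ : Module.Dual F (Matrix (Fin m) (Fin m) F)) : Prop :=
  ∀ α : Γ, α ≠ 0 → ∀ x ∈ glGr d α, χ x = 0

/-- `χ` is standard semisimple: it is of degree zero and vanishes on `N⁺` and on `N⁻`. -/
structure IsStandardSemisimple (χ : Module.Dual F (Matrix (Fin m) (Fin m) F)) : Prop where
  degreeZero : IsDegreeZero d χ
  nil_pos : ∀ i j : Fin m, i < j → χ (Matrix.single i j 1) = 0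
  nil_neg : ∀ i j : Fin m, j < i → χ (Matrix.single i j 1) = 0

open Classical in
/-- The element `H_δ` for the root `δ = ε_i - ε_j`, whose root vector `e_ij` has degree
`d i - d j`. -/
def corootH (i j : Fin m) : Matrix (Fin m) (Fin m) F :=
  if ε.IsEven (d i - d j) then Matrix.single i i 1 - Matrix.single j j 1
  else Matrix.single i i 1 + Matrix.single j j 1

/-- `χ` is regular semisimple: it is standard semisimple and `χ(H_δ) ≠ 0` for all positive
roots `δ`. -/
structure IsRegularSemisimple (χ : Module.Dual F (Matrix (Fin m) (Fin m) F)) : Prop where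
  standardSemisimple : IsStandardSemisimple d χ
  regular : ∀ i j : Fin m, i < j → χ (corootH ε d i j) ≠ 0

/-- The weights `wt ∈ H*` such that `wt(h)^p - wt(h^[p]) = χ(h)^p` for all `h ∈ H`; an element of
`H` is given by its vector of diagonal entries. -/
def IsWeight (p : ℕ) (χ : Module.Dual F (Matrix (Fin m) (Fin m) F))
    (wt : Module.Dual F (Fin m → F)) : Prop :=
  ∀ h : Fin m → F, wt h ^ p - wt (h ^ p) = χ (Matrix.diagonal h) ^ p

variable {d} in
theorem IsStandardSemisimple.apply_eq {χ : Module.Dual F (Matrix (Fin m) (Fin m) F)}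
    (hχ : IsStandardSemisimple d χ) (x : Matrix (Fin m) (Fin m) F) :
    χ x = χ (Matrix.diagonal x.diag) := by
  have h : ∀ i j : Fin m, i ≠ j → ∀ c : F, χ (Matrix.single i j c) = 0 := by
    intro i j hij c
    have h1 : χ (Matrix.single i j 1) = 0 := by
      rcases lt_or_gt_of_ne hij with h | h
      · exact hχ.nil_pos i j h
      · exact hχ.nil_neg i j h
    have h2 : (Matrix.single i j c : Matrix (Fin m) (Fin m) F) = c • Matrix.single i j 1 := by
      simp
    rw [h2, map_smul, h1, smul_zero]
  have hsum : ∀ y : Matrix (Fin m) (Fin m) F,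
      χ y = ∑ i, ∑ j, χ (Matrix.single i j (y i j)) := by
    intro y
    conv_lhs => rw [Matrix.matrix_eq_sum_single y]
    simp only [map_sum]
  rw [hsum x, hsum (Matrix.diagonal x.diag)]
  refine Finset.sum_congr rfl fun i _ => Finset.sum_congr rfl fun j _ => ?_
  by_cases hij : i = j
  · subst hij; simp
  · rw [h i j hij, h i j hij]

/-- The one-dimensional `u_χ(B)`-module `F v`, with `N⁺ v = 0` and `h v = wt(h) v` for `h ∈ H`. -/
def weightModule (p : ℕ) {χ : Module.Dual F (Matrix (Fin m) (Fin m) F)}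
    (hχ : IsStandardSemisimple d χ) {wt : Module.Dual F (Fin m → F)} (hwt : IsWeight p χ wt) :
    RedEnv (borel ε d p) χ →ₐ[F] Module.End F F :=
  (Algebra.lmul F F).comp <|
    redLift (borel ε d p) χ
      (wt ∘ₗ Matrix.diagLinearMap (Fin m) F F ∘ₗ (borel ε d p).carrier.subtype)
      (by
        intro α β x y hx hy
        have hxy := diag_mul_of_upperTriangular x.2 y.2
        have hyx := diag_mul_of_upperTriangular y.2 x.2
        change wt x.1.diag * wt y.1.diag - ε.val α β • (wt y.1.diag * wt x.1.diag)
          = wt (colorBracket ε α β x.1 y.1).diag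
        rw [colorBracket, Matrix.diag_sub, Matrix.diag_smul, hxy, hyx, map_sub, map_smul]
        by_cases hα : α = 0
        · subst hα
          rw [ε.val_zero_left, one_smul, one_smul, mul_comm (wt _), mul_comm x.1.diag]
          simp
        · rw [diag_eq_zero_of_mem_glGr hα hx]
          simp)
      (by
        intro α x _ _
        change wt x.1.diag ^ p - wt (x.1 ^ p).diag = χ x.1 ^ p
        rw [diag_pow_of_upperTriangular x.2, hχ.apply_eq x.1]
        exact hwt x.1.diag)

theorem weightModule_ι (p : ℕ) {χ : Module.Dual F (Matrix (Fin m) (Fin m) F)}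
    (hχ : IsStandardSemisimple d χ) {wt : Module.Dual F (Fin m → F)} (hwt : IsWeight p χ wt)
    (b : (borel ε d p).carrier) (c : F) :
    weightModule ε d p hχ hwt (redι (borel ε d p) χ b) c = wt b.1.diag * c := by
  unfold weightModule
  rw [AlgHom.comp_apply, redLift_ι]
  rfl

open Classical in
/-- The grading of the one-dimensional space `F v` with `v` of degree `γ₀`. -/
def lineGr (F : Type*) [Field F] (γ₀ γ : Γ) : Submodule F F := if γ = γ₀ then ⊤ else ⊥

/-- The baby Verma module `Z^χ(wt) = u_χ(g) ⊗_{u_χ(B)} F v`. -/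
abbrev BabyVerma (p : ℕ) {χ : Module.Dual F (Matrix (Fin m) (Fin m) F)}
    (hχ : IsStandardSemisimple d χ) {wt : Module.Dual F (Fin m → F)} (hwt : IsWeight p χ wt) :
    Type _ :=
  Induced (redIncl (borel ε d p) χ) (weightModule ε d p hχ hwt)

/-- The `Γ`-grading of the baby Verma module whose generator `1 ⊗ v` has degree `γ₀`. -/
def BabyVerma.gr (p : ℕ) {χ : Module.Dual F (Matrix (Fin m) (Fin m) F)}
    (hχ : IsStandardSemisimple d χ) {wt : Module.Dual F (Fin m → F)} (hwt : IsWeight p χ wt)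
    (γ₀ α : Γ) : Submodule F (BabyVerma ε d p hχ hwt) :=
  Induced.gr (redIncl (borel ε d p) χ) (weightModule ε d p hχ hwt)
    (redGr (gl ε d p) χ) (lineGr F γ₀) α

end BabyVerma

end ColorLie

end

open scoped TensorProduct

noncomputable section

namespace ColorLie

/-! ### Bicharacters -/

section BicharacterLemmas

variable {F : Type*} [Field F] {Γ : Type*} [AddCommGroup Γ] (ε : Bicharacter F Γ)

/-! Simplicity and nonvanishing are separate arguments, and neither needs a PBW basis.

Simplicity. Let `v` be the generator, and let the Levi algebra of level `k` be generated by the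
diagonal units and the `e_ij` with `i, j < k`. By induction on `k`, every nonzero `w` in the Levi
orbit of `v` can be carried back to `v` (`exists_smul_eq_of_mem_orbit`). Passing from level `K` to
`K + 1` adds a row of lowering operators `e_Kj` and a column of raising operators `e_jK`, `j < K`.
The row operators are nilpotent and commute up to scalars, and their ordered monomials applied to
the old orbit span the new one (`orbit_le_monomialSpan`). Hence a suitable monomial sends `w` to `X
w'`, where `X` is the product of the maximal powers of the row and `w' ≠ 0` lies in the old orbit.
By induction `w'` can be carried to `v`, and `X` can be moved past the smaller Levi algebra
(`exists_topMonomial_mul`), so `X v` is reached from `w`. Finally `X v` is raised back to `v` one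
root at a time (`exists_smul_topMonomial_eq`), by the `sl₂` formula for `e^(p-1) f^(p-1)` at an even
root and by a `gl(1|1)` computation at an odd one. The scalars that appear are nonzero because the
weight never takes a value in the prime field on a coroot `H`: there `λ(H)^p - λ(H) = χ(H)^p ≠ 0`,
whereas `n^p = n` for an integer `n`.

Nonvanishing. By Frobenius reciprocity it is enough to find one `u_χ(g)`-module with a nonzero
highest weight vector of weight `λ`. It is built from color oscillators `X_ia`, `D_ia` acting on
functions of occupation numbers in `ℤ`, through the Jordan–Schwinger formula `e_ij = ∑ₐ X_ia D_ja`.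
Shifting the number operators of the diagonal sites by constants `μ_i` realizes every admissible
`λ`. Jacobson's formula (`add_pow_prime_sub_mem`, applied in `ofUnits_pow`) reduces the `p`-map
relations to matrix units. -/

theorem Bicharacter.val_add_left (α β γ : Γ) : ε.val (α + β) γ = ε.val α γ * ε.val β γ := by
  simp [Bicharacter.val, ε.map_add_left]

theorem Bicharacter.val_add_right (α β γ : Γ) : ε.val α (β + γ) = ε.val α β * ε.val α γ := by
  simp [Bicharacter.val, ε.map_add_right]

theorem Bicharacter.val_mul_swap (α β : Γ) : ε.val α β * ε.val β α = 1 := by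
  simp only [Bicharacter.val, ← Units.val_mul, ε.mul_swap, Units.val_one]

theorem Bicharacter.val_ne_zero (α β : Γ) : ε.val α β ≠ 0 := Units.ne_zero _

theorem Bicharacter.val_zero_right (α : Γ) : ε.val α 0 = 1 := by
  simpa [ε.val_zero_left] using ε.val_mul_swap α 0

theorem Bicharacter.val_neg_left (α β : Γ) : ε.val (-α) β = ε.val β α := by
  have h := ε.val_add_left (-α) α β
  rw [neg_add_cancel, ε.val_zero_left] at h
  exact mul_right_cancel₀ (ε.val_ne_zero α β) (by rw [← h, ε.val_mul_swap])

theorem Bicharacter.val_neg_right (α β : Γ) : ε.val α (-β) = ε.val β α := by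
  have h := ε.val_mul_swap α (-β)
  rw [ε.val_neg_left] at h
  exact mul_right_cancel₀ (ε.val_ne_zero α β) (by rw [h, ε.val_mul_swap])

theorem Bicharacter.val_self_of_not_isEven {γ : Γ} (h : ¬ ε.IsEven γ) : ε.val γ γ = -1 :=
  (mul_self_eq_one_iff.mp (ε.val_mul_swap γ γ)).resolve_left h

theorem Bicharacter.isEven_zero : ε.IsEven 0 := ε.val_zero_left 0

theorem Bicharacter.isEven_neg {γ : Γ} : ε.IsEven (-γ) ↔ ε.IsEven γ := by
  rw [Bicharacter.IsEven, ε.val_neg_left, ε.val_neg_left, Bicharacter.IsEven]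

end BicharacterLemmas

/-! ### Ordered monomials in quasi-commuting nilpotent operators -/

section Monomials

variable (F : Type*) [Field F] {A : Type*} [Ring A] [Algebra F A]

/-- `a` and `b` commute up to a nonzero scalar. -/
def QuasiCommute (a b : A) : Prop := ∃ c : F, c ≠ 0 ∧ a * b = c • (b * a)

variable {F}

theorem QuasiCommute.symm {a b : A} (h : QuasiCommute F a b) : QuasiCommute F b a := by
  obtain ⟨c, hc, h⟩ := h
  exact ⟨c⁻¹, inv_ne_zero hc, by rw [h, smul_smul, inv_mul_cancel₀ hc, one_smul]⟩

theorem QuasiCommute.one_right (a : A) : QuasiCommute F a 1 := ⟨1, one_ne_zero, by simp⟩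

theorem QuasiCommute.mul_right {a b c : A} (hb : QuasiCommute F a b) (hc : QuasiCommute F a c) :
    QuasiCommute F a (b * c) := by
  obtain ⟨r, hr, hb⟩ := hb
  obtain ⟨s, hs, hc⟩ := hc
  refine ⟨r * s, mul_ne_zero hr hs, ?_⟩
  rw [← mul_assoc, hb, smul_mul_assoc, mul_assoc, hc, mul_smul_comm, smul_smul, mul_assoc]

theorem QuasiCommute.pow_right {a b : A} (hb : QuasiCommute F a b) (n : ℕ) :
    QuasiCommute F a (b ^ n) := by
  induction n with
  | zero => simpa using QuasiCommute.one_right a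
  | succ n ih => rw [pow_succ]; exact ih.mul_right hb

theorem QuasiCommute.pow_left {a b : A} (hb : QuasiCommute F a b) (n : ℕ) :
    QuasiCommute F (a ^ n) b := (hb.symm.pow_right n).symm

theorem QuasiCommute.mul_left {a b c : A} (ha : QuasiCommute F a c) (hb : QuasiCommute F b c) :
    QuasiCommute F (a * b) c := (ha.symm.mul_right hb.symm).symm

variable {ι : Type*}

/-- The product of the powers `x_j ^ t_j` along a list of indices. -/
def topMonomial (x : ι → A) (t : ι → ℕ) (l : List ι) : A := (l.map fun j => x j ^ t j).prod

@[simp]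
theorem topMonomial_nil (x : ι → A) (t : ι → ℕ) : topMonomial x t [] = 1 := rfl

@[simp]
theorem topMonomial_cons (x : ι → A) (t : ι → ℕ) (j : ι) (l : List ι) :
    topMonomial x t (j :: l) = x j ^ t j * topMonomial x t l := by
  simp [topMonomial]

theorem QuasiCommute.topMonomial {x : ι → A} {a : A} (h : ∀ j, QuasiCommute F a (x j))
    (t : ι → ℕ) (l : List ι) : QuasiCommute F a (topMonomial x t l) := by
  induction l with
  | nil => exact QuasiCommute.one_right a
  | cons j l ih => rw [topMonomial_cons]; exact ((h j).pow_right _).mul_right ih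

/-- Up to scalars `x j` moves past the earlier factors until it meets `x j ^ t j`, which it raises
to a vanishing power. -/
theorem mul_topMonomial_eq_zero {x : ι → A} {t : ι → ℕ}
    (hx : ∀ i j, QuasiCommute F (x i) (x j)) (ht : ∀ j, x j ^ (t j + 1) = 0)
    {l : List ι} {j : ι} (hj : j ∈ l) : x j * topMonomial x t l = 0 := by
  induction l with
  | nil => simp at hj
  | cons i l ih =>
    rw [topMonomial_cons, ← mul_assoc]
    by_cases hij : j = i
    · subst hij
      rw [← pow_succ', ht, zero_mul]
    · obtain ⟨c, -, hc⟩ := (hx j i).pow_right (t i)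
      rw [hc, smul_mul_assoc, mul_assoc, ih (by simpa [hij] using hj), mul_zero, smul_zero]

variable {Z : Type*} [AddCommGroup Z] [Module A Z] [Module F Z] [IsScalarTower F A Z]

/-- The span of the vectors `x_{j₁}^{a₁} ⋯ x_{j_r}^{a_r} w` with `w ∈ W` and `a_i ≤ t_{j_i}`,
for a list of indices `j₁, …, j_r`. -/
def monomialSpan (x : ι → A) (t : ι → ℕ) (W : Submodule F Z) : List ι → Submodule F Z
  | [] => W
  | j :: l =>
    -- The coefficients `g a` only have to exist. Their uniqueness, which would amount to a PBW
    -- theorem, is never needed.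
    { carrier := {w | ∃ g : ℕ → Z, (∀ a, g a ∈ monomialSpan x t W l) ∧
        w = ∑ a ∈ Finset.range (t j + 1), x j ^ a • g a}
      add_mem' := by
        rintro _ _ ⟨g, hg, rfl⟩ ⟨g', hg', rfl⟩
        exact ⟨fun a => g a + g' a, fun a => add_mem (hg a) (hg' a), by
          simp [smul_add, Finset.sum_add_distrib]⟩
      zero_mem' := ⟨0, fun _ => zero_mem _, by simp⟩
      smul_mem' := by
        rintro c _ ⟨g, hg, rfl⟩
        exact ⟨fun a => c • g a, fun a => Submodule.smul_mem _ c (hg a), by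
          simp [Finset.smul_sum, smul_comm c]⟩ }

theorem mem_monomialSpan_cons {x : ι → A} {t : ι → ℕ} {W : Submodule F Z} {j : ι} {l : List ι}
    {w : Z} : w ∈ monomialSpan x t W (j :: l) ↔ ∃ g : ℕ → Z, (∀ a, g a ∈ monomialSpan x t W l) ∧
        w = ∑ a ∈ Finset.range (t j + 1), x j ^ a • g a := Iff.rfl

theorem monomialSpan_le_cons (x : ι → A) (t : ι → ℕ) (W : Submodule F Z) (j : ι) (l : List ι) :
    monomialSpan x t W l ≤ monomialSpan x t W (j :: l) := by
  intro w hw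
  refine mem_monomialSpan_cons.mpr ⟨fun a => if a = 0 then w else 0, fun a => ?_, ?_⟩
  · dsimp only; split_ifs
    exacts [hw, zero_mem _]
  · rw [Finset.sum_eq_single 0] <;> simp +contextual

theorem le_monomialSpan (x : ι → A) (t : ι → ℕ) (W : Submodule F Z) (l : List ι) :
    W ≤ monomialSpan x t W l := by
  induction l with
  | nil => exact le_rfl
  | cons j l ih => exact ih.trans (monomialSpan_le_cons x t W j l)

theorem smul_mem_monomialSpan {x : ι → A} {t : ι → ℕ}
    (hx : ∀ i j, QuasiCommute F (x i) (x j)) (ht : ∀ j, x j ^ (t j + 1) = 0)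
    {W : Submodule F Z} {l : List ι} {i : ι} (hi : i ∈ l) {w : Z}
    (hw : w ∈ monomialSpan x t W l) : x i • w ∈ monomialSpan x t W l := by
  induction l generalizing w with
  | nil => simp at hi
  | cons j l ih =>
    obtain ⟨g, hg, rfl⟩ := mem_monomialSpan_cons.mp hw
    by_cases hij : i = j
    · subst hij
      -- Multiplication by `x i` shifts the exponents by one; the term that leaves the range carries
      -- `x i ^ (t i + 1) = 0`.
      refine mem_monomialSpan_cons.mpr ⟨fun a => if a = 0 then 0 else g (a - 1), fun a => ?_, ?_⟩
      · dsimp only; split_ifs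
        exacts [zero_mem _, hg _]
      · rw [Finset.smul_sum, Finset.sum_range_succ, Finset.sum_range_succ']
        simp only [smul_smul, ← pow_succ', ht]
        simp
    · choose c hc using fun a : ℕ => (hx i j).pow_right a
      refine mem_monomialSpan_cons.mpr ⟨fun a => c a • x i • g a,
        fun a => Submodule.smul_mem _ _ (ih (by simpa [hij] using hi) (hg a)), ?_⟩
      rw [Finset.smul_sum]
      refine Finset.sum_congr rfl fun a _ => ?_
      rw [smul_smul, (hc a).2, smul_assoc, mul_smul, smul_comm (c a)]

theorem monomialSpan_le {x : ι → A} {t : ι → ℕ} {W P : Submodule F Z} {l : List ι} (hW : W ≤ P)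
    (hP : ∀ j ∈ l, ∀ w ∈ P, x j • w ∈ P) : monomialSpan x t W l ≤ P := by
  induction l with
  | nil => exact hW
  | cons j l ih =>
    intro w hw
    obtain ⟨g, hg, rfl⟩ := mem_monomialSpan_cons.mp hw
    have hpow : ∀ (a : ℕ), ∀ w ∈ P, x j ^ a • w ∈ P := by
      intro a
      induction a with
      | zero => simp
      | succ a iha =>
        intro w hw
        rw [pow_succ', mul_smul]
        exact hP j (by simp) _ (iha w hw)
    exact sum_mem fun a _ =>
      hpow a _ (ih (fun i hi => hP i (List.mem_cons_of_mem _ hi)) (hg a))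

/-- The vectors of the span that `a` keeps in the span form a subspace `P`; if `P` contains `W` and
is stable under each `x j`, it is everything. Stability under `a` is thus reduced to commuting `a`
past a single `x j`, with both `w` and `a • w` available for the terms that arise. -/
theorem monomialSpan_smul_mem {x : ι → A} {t : ι → ℕ} {W : Submodule F Z} {l : List ι} {a : A}
    (hW : ∀ w ∈ W, a • w ∈ monomialSpan x t W l)
    (h : ∀ j ∈ l, ∀ w ∈ monomialSpan x t W l, a • w ∈ monomialSpan x t W l →
      x j • w ∈ monomialSpan x t W l ∧ a • x j • w ∈ monomialSpan x t W l)
    {w : Z} (hw : w ∈ monomialSpan x t W l) : a • w ∈ monomialSpan x t W l := by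
  let P : Submodule F Z := monomialSpan x t W l ⊓
    (monomialSpan x t W l).comap (Algebra.lsmul F F Z a)
  have hle : monomialSpan x t W l ≤ P := by
    refine monomialSpan_le (fun w hw => ⟨le_monomialSpan x t W l hw, hW w hw⟩) ?_
    rintro j hj w ⟨hw1, hw2⟩
    exact h j hj w hw1 hw2
  exact (hle hw).2

/-- Every nonzero vector of a monomial span is moved by a monomial into `x_top W`. -/
theorem exists_smul_eq_topMonomial_smul {x : ι → A} {t : ι → ℕ}
    (hx : ∀ i j, QuasiCommute F (x i) (x j)) (ht : ∀ j, x j ^ (t j + 1) = 0)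
    {U : Subalgebra F A} {W : Submodule F Z} {l : List ι} (hU : ∀ j ∈ l, x j ∈ U) {w : Z}
    (hw : w ∈ monomialSpan x t W l) (hw0 : w ≠ 0) :
    ∃ u ∈ U, (∀ i, QuasiCommute F u (x i)) ∧ ∃ w' ∈ W, w' ≠ 0 ∧
      u • w = topMonomial x t l • w' := by
  classical
  induction l generalizing w with
  | nil =>
    exact ⟨1, one_mem _, fun i => (QuasiCommute.one_right _).symm, w, hw, hw0, by simp⟩
  | cons j l ih =>
    obtain ⟨g, hg, rfl⟩ := mem_monomialSpan_cons.mp hw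
    -- Take the lowest exponent `a` with nonzero coefficient. Multiplication by `x j ^ (t j - a)`
    -- pushes all later terms beyond the exponent `t j`, so only `x j ^ t j • g a` survives.
    have hex : ∃ a, a < t j + 1 ∧ g a ≠ 0 := by
      by_contra! hall
      exact hw0 (Finset.sum_eq_zero fun a ha => by rw [hall a (Finset.mem_range.mp ha), smul_zero])
    obtain ⟨ha1, ha2⟩ := Nat.find_spec hex
    set a := Nat.find hex with ha
    have hmin : ∀ b < a, g b = 0 := by
      intro b hb
      by_contra hgb
      exact Nat.find_min hex hb ⟨hb.trans ha1, hgb⟩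
    have hsum : x j ^ (t j - a) • ∑ b ∈ Finset.range (t j + 1), x j ^ b • g b
        = x j ^ t j • g a := by
      rw [Finset.smul_sum, Finset.sum_eq_single a]
      · rw [smul_smul, ← pow_add, Nat.sub_add_cancel (by omega)]
      · intro b _ hb
        rcases lt_or_gt_of_ne hb with h | h
        · rw [hmin b h, smul_zero, smul_zero]
        · rw [smul_smul, ← pow_add, show t j - a + b = (t j + 1) + (b - a - 1) by omega, pow_add,
            ht, zero_mul, zero_smul]
      · intro h; exact absurd (Finset.mem_range.mpr ha1) h
    obtain ⟨u, huU, hu, w', hw', hw'0, huw⟩ :=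
      ih (fun i hi => hU i (List.mem_cons_of_mem _ hi)) (hg a) ha2
    -- Moving `u` past `x j ^ t j` costs a nonzero scalar, absorbed into `w'`; this is why
    -- quasi-commutation of `u` is carried through the induction.
    obtain ⟨c, hc, hcomm⟩ := (hu j).pow_right (t j)
    refine ⟨u * x j ^ (t j - a), mul_mem huU (pow_mem (hU j (by simp)) _),
      fun i => (hu i).mul_left ((hx j i).pow_left _), c • w', Submodule.smul_mem _ _ hw',
      smul_ne_zero hc hw'0, ?_⟩
    rw [mul_smul, hsum, smul_smul, hcomm, smul_assoc, mul_smul, huw, topMonomial_cons, mul_smul,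
      smul_comm c, smul_comm c]

end Monomials

/-! ### Highest weight vectors -/

section HighestWeight

variable {F : Type*} [Field F] {Γ : Type*} [AddCommGroup Γ] {m : ℕ}
variable {A : Type*} [Ring A] [Algebra F A]

/-- The elements `E i j` satisfy the bracket relations of the matrix units of `gl(m, Γ)`. -/
def IsColorMatrixUnits (ε : Bicharacter F Γ) (d : Fin m → Γ) (E : Fin m → Fin m → A) : Prop :=
  ∀ i j k l, E i j * E k l = ε.val (d i - d j) (d k - d l) • (E k l * E i j)
    + ((if j = k then E i l else 0)
      - ε.val (d i - d j) (d k - d l) • (if l = i then E k j else 0))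

open Classical in
/-- The largest exponent of a root vector of degree `γ` in a monomial: `p - 1` if `γ` is even and
`1` otherwise. -/
def topExp (ε : Bicharacter F Γ) (p : ℕ) (γ : Γ) : ℕ := if ε.IsEven γ then p - 1 else 1

variable {ε : Bicharacter F Γ} {d : Fin m → Γ} {E : Fin m → Fin m → A}

theorem IsColorMatrixUnits.quasiCommute (hE : IsColorMatrixUnits ε d E) {i j k l : Fin m}
    (hjk : j ≠ k) (hli : l ≠ i) : QuasiCommute F (E i j) (E k l) :=
  ⟨ε.val (d i - d j) (d k - d l), ε.val_ne_zero _ _, by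
    rw [hE i j k l, if_neg hjk, if_neg hli]; simp⟩

/-- Regularity is a condition modulo integers, so the eigenvalue of `E i i` on a root vector matters
only through being an integer and is left existential. -/
theorem IsColorMatrixUnits.diag_mul (hE : IsColorMatrixUnits ε d E) (i k l : Fin m) :
    ∃ n : ℤ, E i i * E k l = E k l * E i i + (n : F) • E k l := by
  refine ⟨(if i = k then 1 else 0) - (if l = i then 1 else 0), ?_⟩
  rw [hE i i k l, sub_self, ε.val_zero_left]
  by_cases h1 : i = k
  · subst h1
    by_cases h2 : l = i
    · subst h2; simp
    · simp [h2]
  · by_cases h2 : l = i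
    · subst h2; simp [h1]
    · simp [h1, h2]

/-- The subalgebra generated by the diagonal units and the units `E i j` with `i, j < k`. -/
def leviAlgebra (F : Type*) [Field F] [Algebra F A] (E : Fin m → Fin m → A) (k : ℕ) :
    Subalgebra F A :=
  Algebra.adjoin F {a | ∃ i j : Fin m, (i = j ∨ (i.val < k ∧ j.val < k)) ∧ a = E i j}

theorem mem_leviAlgebra {k : ℕ} {i j : Fin m} (h : i = j ∨ (i.val < k ∧ j.val < k)) :
    E i j ∈ leviAlgebra F E k := Algebra.subset_adjoin ⟨i, j, h, rfl⟩

theorem leviAlgebra_mono {k k' : ℕ} (h : k ≤ k') : leviAlgebra F E k ≤ leviAlgebra F E k' := by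
  refine Algebra.adjoin_mono ?_
  rintro _ ⟨i, j, hij, rfl⟩
  exact ⟨i, j, hij.imp_right fun h' => ⟨h'.1.trans_le h, h'.2.trans_le h⟩, rfl⟩

variable {Z : Type*} [AddCommGroup Z] [Module A Z] [Module F Z] [IsScalarTower F A Z]

/-- The subspace `U v` for a subalgebra `U`. -/
def orbit (U : Subalgebra F A) (v : Z) : Submodule F Z :=
  (Subalgebra.toSubmodule U).map ((LinearMap.toSpanSingleton A Z v).restrictScalars F)

theorem mem_orbit {U : Subalgebra F A} {v w : Z} : w ∈ orbit U v ↔ ∃ u ∈ U, u • v = w := by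
  simp [orbit, Submodule.mem_map]

theorem smul_mem_orbit {U : Subalgebra F A} {v w : Z} {u : A} (hu : u ∈ U) (hw : w ∈ orbit U v) :
    u • w ∈ orbit U v := by
  obtain ⟨u', hu', rfl⟩ := mem_orbit.mp hw
  exact mem_orbit.mpr ⟨u * u', mul_mem hu hu', mul_smul _ _ _⟩

theorem IsColorMatrixUnits.smul_smul_eq (hE : IsColorMatrixUnits ε d E) (i j k l : Fin m) (w : Z) :
    E i j • E k l • w = ε.val (d i - d j) (d k - d l) • E k l • E i j • w
      + ((if j = k then E i l • w else 0)
        - ε.val (d i - d j) (d k - d l) • (if l = i then E k j • w else 0)) := by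
  rw [← mul_smul, hE i j k l, add_smul, sub_smul, smul_assoc, smul_assoc, mul_smul]
  split_ifs <;> simp

/-- The annihilator of a vector by a column of raising operators is stable under the Levi
subalgebra. -/
theorem IsColorMatrixUnits.smul_eq_zero_of_mem_leviAlgebra (hE : IsColorMatrixUnits ε d E)
    {K : Fin m} {u : A} (hu : u ∈ leviAlgebra F E K.val) {w : Z}
    (hw : ∀ i < K, E i K • w = 0) : ∀ i < K, E i K • u • w = 0 := by
  induction hu using Algebra.adjoin_induction generalizing w with
  | mem a ha =>
    obtain ⟨a, b, hab, rfl⟩ := ha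
    intro i hi
    rw [hE.smul_smul_eq, hw i hi, smul_zero, smul_zero, zero_add]
    -- Both bracket terms are again raising operators of column `K`: `K = a` forces `a = b = K`,
    -- giving `E i K`, and `b = i` gives `E a K` with `a < K`.
    have h1 : (if K = a then E i b • w else 0) = 0 := by
      split_ifs with h
      · subst h
        rcases hab with rfl | h
        · exact hw i hi
        · exact absurd h.1 (lt_irrefl _)
      · rfl
    have h2 : (if b = i then E a K • w else 0) = 0 := by
      split_ifs with h
      · subst h
        rcases hab with rfl | h
        · exact hw _ hi
        · exact hw _ h.1
      · rfl
    rw [h1, h2, smul_zero, sub_zero]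
  | algebraMap r => intro i hi; rw [algebraMap_smul, smul_comm, hw i hi, smul_zero]
  | add x y _ _ hx hy => intro i hi; rw [add_smul, smul_add, hx hw i hi, hy hw i hi, add_zero]
  | mul x y _ _ hx hy => intro i hi; rw [mul_smul]; exact hx (hy hw) i hi

/-- The lowering operators `E K j`, `j < K`, of a row. -/
def lowerRow (E : Fin m → Fin m → A) (K : Fin m) (j : {j : Fin m // j < K}) : A := E K j.1

theorem IsColorMatrixUnits.lowerRow_quasiCommute (hE : IsColorMatrixUnits ε d E) (K : Fin m)
    (i j : {j : Fin m // j < K}) : QuasiCommute F (lowerRow E K i) (lowerRow E K j) :=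
  hE.quasiCommute i.2.ne j.2.ne

theorem lowerRow_mem {K : Fin m} (j : {j : Fin m // j < K}) :
    lowerRow E K j ∈ leviAlgebra F E (K.val + 1) :=
  mem_leviAlgebra (Or.inr ⟨Nat.lt_succ_self _, Nat.lt_succ_of_lt j.2⟩)

/-- The orbit of a highest weight vector under the next Levi subalgebra is spanned by the ordered
monomials in the lowering operators of one row, applied to the previous orbit. -/
theorem IsColorMatrixUnits.orbit_le_monomialSpan (hE : IsColorMatrixUnits ε d E)
    {K : Fin m} {t : {j : Fin m // j < K} → ℕ} (ht : ∀ j, lowerRow E K j ^ (t j + 1) = 0)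
    {l : List {j : Fin m // j < K}} (hl : ∀ j, j ∈ l) {v : Z} (hv : ∀ i < K, E i K • v = 0) :
    orbit (leviAlgebra F E (K.val + 1)) v
      ≤ monomialSpan (lowerRow E K) t (orbit (leviAlgebra F E K.val) v) l := by
  set W := orbit (leviAlgebra F E K.val) v with hWdef
  set T := monomialSpan (lowerRow E K) t W l with hT
  -- The next Levi algebra is generated by row `K`, the old Levi generators and column `K`.
  -- Stability of `T` is shown in this order, because bracketing a later family with row `K`
  -- produces only operators from families already treated.
  have hf : ∀ (j : Fin m), j < K → ∀ w ∈ T, E K j • w ∈ T := fun j hj w hw =>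
    smul_mem_monomialSpan (hE.lowerRow_quasiCommute K) ht (hl ⟨j, hj⟩) hw
  have hlevi : ∀ i j : Fin m, (i = j ∨ (i < K ∧ j < K)) → ∀ w ∈ T, E i j • w ∈ T := by
    intro i j hij w hw
    refine monomialSpan_smul_mem (fun w hw => ?_) ?_ hw
    · exact le_monomialSpan _ _ _ _ (smul_mem_orbit (mem_leviAlgebra hij) hw)
    · intro k _ w hw1 hw2
      refine ⟨hf _ k.2 _ hw1, ?_⟩
      rw [lowerRow, hE.smul_smul_eq]
      refine add_mem (Submodule.smul_mem _ _ (hf _ k.2 _ hw2))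
        (sub_mem ?_ (Submodule.smul_mem _ _ ?_))
      · split_ifs with h
        · rcases hij with rfl | h'
          · rw [h]; exact hf _ k.2 _ hw1
          · exact absurd h h'.2.ne
        · exact zero_mem _
      · split_ifs with h
        · rcases hij with rfl | h'
          · rw [← h]; exact hf _ k.2 _ hw1
          · exact hf _ h'.2 _ hw1
        · exact zero_mem _
  have he : ∀ i : Fin m, i < K → ∀ w ∈ T, E i K • w ∈ T := by
    intro i hi w hw
    refine monomialSpan_smul_mem (fun w hw => ?_) ?_ hw
    · obtain ⟨u, hu, rfl⟩ := mem_orbit.mp hw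
      rw [hE.smul_eq_zero_of_mem_leviAlgebra hu hv i hi]
      exact zero_mem _
    · intro k _ w hw1 hw2
      refine ⟨hf _ k.2 _ hw1, ?_⟩
      rw [lowerRow, hE.smul_smul_eq]
      refine add_mem (Submodule.smul_mem _ _ (hf _ k.2 _ hw2))
        (sub_mem ?_ (Submodule.smul_mem _ _ ?_))
      · rw [if_pos rfl]; exact hlevi _ _ (Or.inr ⟨hi, k.2⟩) _ hw1
      · split_ifs
        · exact hlevi _ _ (Or.inl rfl) _ hw1
        · exact zero_mem _
  intro w hw
  obtain ⟨u, hu, rfl⟩ := mem_orbit.mp hw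
  have hvT : v ∈ T := le_monomialSpan _ _ _ _ (mem_orbit.mpr ⟨1, one_mem _, one_smul _ _⟩)
  have key : ∀ w ∈ T, u • w ∈ T := by
    clear hw
    induction hu using Algebra.adjoin_induction with
    | mem a ha =>
      obtain ⟨i, j, hij, rfl⟩ := ha
      by_cases h : i = j
      · exact hlevi i j (Or.inl h)
      obtain ⟨hi, hj⟩ := hij.resolve_left h
      rcases (Nat.lt_succ_iff_lt_or_eq.mp hi) with hi | hi <;>
        rcases (Nat.lt_succ_iff_lt_or_eq.mp hj) with hj | hj
      · exact hlevi i j (Or.inr ⟨hi, hj⟩)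
      · obtain rfl : j = K := Fin.ext hj
        exact he i hi
      · obtain rfl : i = K := Fin.ext hi
        exact hf j hj
      · exact absurd (Fin.ext (hi.trans hj.symm)) h
    | algebraMap r => intro w hw; rw [algebraMap_smul]; exact Submodule.smul_mem _ _ hw
    | add x y _ _ hx hy => intro w hw; rw [add_smul]; exact add_mem (hx w hw) (hy w hw)
    | mul x y _ _ hx hy => intro w hw; rw [mul_smul]; exact hx _ (hy w hw)
  exact key v hvT

end HighestWeight

/-! ### Moving operators past the top monomial -/

section TopMonomial

variable {F : Type*} [Field F] {A : Type*} [Ring A] [Algebra F A] {ι : Type*}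

/-- The commutator with `a` is a derivation with each `x j` as an eigenvector of integer eigenvalue,
so products are eigenvectors too and the eigenvalues add. -/
theorem exists_mul_topMonomial_of_mul_eq_add_smul {x : ι → A} {a : A}
    (h : ∀ j, ∃ n : ℤ, a * x j = x j * a + (n : F) • x j) (t : ι → ℕ) (l : List ι) :
    ∃ n : ℤ, a * topMonomial x t l = topMonomial x t l * a + (n : F) • topMonomial x t l := by
  have hmul : ∀ y z : A, (∃ n : ℤ, a * y = y * a + (n : F) • y) →
      (∃ n : ℤ, a * z = z * a + (n : F) • z) →
      ∃ n : ℤ, a * (y * z) = y * z * a + (n : F) • (y * z) := by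
    rintro y z ⟨n, hn⟩ ⟨k, hk⟩
    refine ⟨n + k, ?_⟩
    rw [← mul_assoc, hn, add_mul, mul_assoc, hk, mul_add, Int.cast_add, add_smul]
    simp only [mul_smul_comm, smul_mul_assoc, mul_assoc]
    abel
  have hpow : ∀ (y : A), (∃ n : ℤ, a * y = y * a + (n : F) • y) → ∀ k : ℕ,
      ∃ n : ℤ, a * y ^ k = y ^ k * a + (n : F) • y ^ k := by
    intro y hy k
    induction k with
    | zero => exact ⟨0, by simp⟩
    | succ k ih => rw [pow_succ]; exact hmul _ _ ih hy
  induction l with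
  | nil => exact ⟨0, by simp⟩
  | cons j l ih => rw [topMonomial_cons]; exact hmul _ _ (hpow _ (h j) _) ih

/-- An operator that commutes with all `x_l` up to scalars, except that it replaces `x_i` by `x_j`,
commutes with the top monomial up to a scalar. -/
theorem exists_mul_topMonomial_of_replace [DecidableEq ι] {x : ι → A} {t : ι → ℕ} {a : A}
    {i j : ι} (hij : i ≠ j)
    (hx : ∀ i j, QuasiCommute F (x i) (x j)) (ht : ∀ j, x j ^ (t j + 1) = 0)
    (ha : ∀ k, k ≠ i → QuasiCommute F a (x k))
    (hai : ∃ c : F, c ≠ 0 ∧ ∃ s : F, a * x i = c • (x i * a) + s • x j)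
    {l : List ι} (hl : l.Nodup) (hj : j ∈ l) : QuasiCommute F a (topMonomial x t l) := by
  have hall : ∀ k, ∃ c : F, c ≠ 0 ∧ ∃ s : F, a * x k = c • (x k * a) + s • x j := by
    intro k
    by_cases hk : k = i
    · rw [hk]; exact hai
    · obtain ⟨c, hc, h⟩ := ha k hk
      exact ⟨c, hc, 0, by rw [h, zero_smul, add_zero]⟩
  -- The error term is kept with `x j` on the right, for the case where `x i` precedes `x j`: this
  -- `x j` then meets a tail containing `x j ^ t j` and kills it.
  have hpowR : ∀ n : ℕ, ∃ c : F, c ≠ 0 ∧ ∃ r : A,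
      a * x i ^ n = c • (x i ^ n * a) + r * x j := by
    intro n
    induction n with
    | zero => exact ⟨1, one_ne_zero, 0, by simp⟩
    | succ n ih =>
      obtain ⟨c, hc, r, h⟩ := ih
      obtain ⟨c', hc', s, h'⟩ := hai
      obtain ⟨b, -, hb⟩ := hx j i
      refine ⟨c * c', mul_ne_zero hc hc', (c * s) • x i ^ n + b • (r * x i), ?_⟩
      rw [pow_succ, ← mul_assoc, h, add_mul, smul_mul_assoc, mul_assoc, h', mul_add,
        mul_assoc r, hb, add_mul, smul_add]
      simp only [mul_smul_comm, smul_mul_assoc, mul_assoc, smul_smul]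
      abel
  -- Here the error term has `x j` on the left, for the case where `x j` comes first: it is absorbed
  -- by the preceding `x j ^ t j`, giving zero.
  have hmulL : ∀ y z : A, QuasiCommute F y (x j) →
      (∃ c : F, c ≠ 0 ∧ ∃ r : A, a * y = c • (y * a) + x j * r) →
      (∃ c : F, c ≠ 0 ∧ ∃ r : A, a * z = c • (z * a) + x j * r) →
      ∃ c : F, c ≠ 0 ∧ ∃ r : A, a * (y * z) = c • (y * z * a) + x j * r := by
    rintro y z ⟨b, -, hb⟩ ⟨c, hc, r, h⟩ ⟨c', hc', r', h'⟩
    refine ⟨c * c', mul_ne_zero hc hc', (c * b) • (y * r') + r * z, ?_⟩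
    rw [← mul_assoc, h, add_mul, smul_mul_assoc, mul_assoc y, h', mul_add, ← mul_assoc y (x j), hb,
      mul_add, smul_add]
    simp only [mul_smul_comm, smul_mul_assoc, mul_assoc, smul_smul]
    abel
  have hpowL : ∀ (k : ι) (n : ℕ), ∃ c : F, c ≠ 0 ∧ ∃ r : A,
      a * x k ^ n = c • (x k ^ n * a) + x j * r := by
    intro k n
    induction n with
    | zero => exact ⟨1, one_ne_zero, 0, by simp⟩
    | succ n ih =>
      rw [pow_succ]
      refine hmulL _ _ ((hx k j).pow_left _) ih ?_
      obtain ⟨c, hc, s, h⟩ := hall k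
      exact ⟨c, hc, s • 1, by rw [h, mul_smul_comm, mul_one]⟩
  have htopL : ∀ l : List ι, ∃ c : F, c ≠ 0 ∧ ∃ r : A,
      a * topMonomial x t l = c • (topMonomial x t l * a) + x j * r := by
    intro l
    induction l with
    | nil => exact ⟨1, one_ne_zero, 0, by simp⟩
    | cons k l ih =>
      rw [topMonomial_cons]
      exact hmulL _ _ ((hx k j).pow_left _) (hpowL k _) ih
  have hnot : ∀ l : List ι, i ∉ l → QuasiCommute F a (topMonomial x t l) := by
    intro l hil
    induction l with
    | nil => exact QuasiCommute.one_right a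
    | cons b l ih =>
      rw [topMonomial_cons]
      exact ((ha b fun h => hil (by simp [h])).pow_right _).mul_right
        (ih fun h => hil (List.mem_cons_of_mem _ h))
  induction l with
  | nil => simp at hj
  | cons k l ih =>
    obtain ⟨hk, hl⟩ := List.nodup_cons.mp hl
    rw [topMonomial_cons]
    by_cases hkj : k = j
    · subst hkj
      obtain ⟨c, hc, h⟩ := (ha k hij.symm).pow_right (t k)
      obtain ⟨c', hc', r, h'⟩ := htopL l
      refine ⟨c * c', mul_ne_zero hc hc', ?_⟩
      rw [← mul_assoc, h, smul_mul_assoc, mul_assoc, h', mul_add, ← mul_assoc _ (x k), ← pow_succ,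
        ht, zero_mul, add_zero]
      simp only [mul_smul_comm, mul_assoc, smul_smul]
    · have hjl : j ∈ l := by simpa [Ne.symm hkj] using hj
      by_cases hki : k = i
      · subst hki
        obtain ⟨c, hc, r, h⟩ := hpowR (t k)
        obtain ⟨c', hc', h'⟩ := hnot l hk
        refine ⟨c * c', mul_ne_zero hc hc', ?_⟩
        rw [← mul_assoc, h, add_mul, mul_assoc r, mul_topMonomial_eq_zero hx ht hjl, mul_zero,
          add_zero, smul_mul_assoc, mul_assoc, h']
        simp only [mul_smul_comm, mul_assoc, smul_smul]
      · exact ((ha k hki).pow_right _).mul_right (ih hl hjl)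

end TopMonomial

/-! ### Simplicity of regular highest weight modules -/

section Simplicity

variable {F : Type*} [Field F] {Γ : Type*} [AddCommGroup Γ] {m : ℕ}
variable {A : Type*} [Ring A] [Algebra F A]
variable {Z : Type*} [AddCommGroup Z] [Module A Z] [Module F Z] [IsScalarTower F A Z]

/-- The `sl₂`-computation: `eⁿ fⁿ w` is a nonzero multiple of a primitive vector `w` whose weight
is not an integer. -/
theorem exists_pow_smul_pow_smul_of_sl2 (p : ℕ) [CharP F p] {e f h : A} {w : Z} {μ : F}
    (hef : e * f = f * e + h) (hhf : h * f = f * h - (2 : F) • f) (he : e • w = 0)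
    (hh : h • w = μ • w) (hμ : ∀ n : ℤ, μ ≠ n) {n : ℕ} (hn : n < p) :
    ∃ c : F, c ≠ 0 ∧ e ^ n • f ^ n • w = c • w := by
  have hw : ∀ n : ℕ, h • f ^ n • w = (μ - 2 * n) • f ^ n • w := by
    intro n
    induction n with
    | zero => simp [hh]
    | succ n ih =>
      rw [pow_succ', mul_smul, ← mul_smul h, hhf, sub_smul, mul_smul, ih, smul_assoc,
        smul_comm f (μ - 2 * n : F), ← sub_smul]
      congr 1; push_cast; ring
  have hef' : ∀ n : ℕ, e • f ^ (n + 1) • w = ((n + 1) * (μ - n) : F) • f ^ n • w := by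
    intro n
    induction n with
    | zero => rw [zero_add, pow_one, ← mul_smul, hef, add_smul, mul_smul, he, hh]; simp
    | succ n ih =>
      rw [pow_succ', mul_smul, ← mul_smul e, hef, add_smul, mul_smul, ih, hw, smul_comm f,
        ← mul_smul f, ← pow_succ', ← add_smul]
      congr 1; push_cast; ring
  induction n with
  | zero => exact ⟨1, one_ne_zero, by simp⟩
  | succ n ih =>
    obtain ⟨c, hc, h⟩ := ih (by omega)
    -- The factor `n + 1` is invertible because `n + 1 < p`, and `μ - n` because `μ` is not an
    -- integer.
    refine ⟨(n + 1) * (μ - n) * c, mul_ne_zero (mul_ne_zero ?_ (sub_ne_zero.mpr ?_)) hc, ?_⟩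
    · have := (CharP.cast_eq_zero_iff F p (n + 1)).not.mpr (Nat.not_dvd_of_pos_of_lt (by omega) hn)
      exact_mod_cast this
    · exact_mod_cast hμ n
    · rw [pow_succ e, mul_smul, hef', smul_comm (e ^ n), h, smul_smul]

/-- `v` is a vector of weight `lam`, annihilated by the `E i j` with `i < j`, and `lam` is regular:
its values on coroots are not integers. The root vectors are nilpotent. -/
structure IsRegularHighestWeight (ε : Bicharacter F Γ) (d : Fin m → Γ) (p : ℕ)
    (E : Fin m → Fin m → A) (lam : Fin m → F) (v : Z) : Prop where
  nilpotent : ∀ i j, i ≠ j → E i j ^ (topExp ε p (d i - d j) + 1) = 0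
  raise : ∀ i j, i < j → E i j • v = 0
  weight : ∀ i, E i i • v = lam i • v
  even : ∀ i j, i < j → ε.IsEven (d i - d j) → ∀ n : ℤ, lam i - lam j ≠ n
  odd : ∀ i j, i < j → ¬ ε.IsEven (d i - d j) → ∀ n : ℤ, lam i + lam j ≠ n

variable {ε : Bicharacter F Γ} {d : Fin m → Γ} {p : ℕ} {E : Fin m → Fin m → A}
  {lam : Fin m → F} {v : Z}

/-- The maximal exponents of the lowering operators of a row. -/
def rowExp (ε : Bicharacter F Γ) (d : Fin m → Γ) (p : ℕ) (K : Fin m) (j : {j : Fin m // j < K}) :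
    ℕ := topExp ε p (d K - d j.1)

theorem IsRegularHighestWeight.weight_topMonomial (hv : IsRegularHighestWeight ε d p E lam v)
    (hE : IsColorMatrixUnits ε d E) (K : Fin m) (l : List {j : Fin m // j < K}) (a : Fin m) :
    ∃ n : ℤ, E a a • topMonomial (lowerRow E K) (rowExp ε d p K) l • v
      = (lam a + n) • topMonomial (lowerRow E K) (rowExp ε d p K) l • v := by
  obtain ⟨n, hn⟩ := exists_mul_topMonomial_of_mul_eq_add_smul (F := F) (x := lowerRow E K)
    (a := E a a) (fun j => hE.diag_mul a K j.1) (rowExp ε d p K) l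
  exact ⟨n, by rw [← mul_smul, hn, add_smul, mul_smul, hv.weight, smul_comm _ (lam a), smul_assoc,
    ← add_smul]⟩

/-- As `i < j`, the only bracket term of `E i b` with `E K j` is `E i j`, present when `b = K`. It
is a raising operator of the same kind, so all `b` with `i < b ≤ K` are treated together. For `b =
K` this makes the tail of an increasing monomial primitive for the root of its head. -/
theorem IsRegularHighestWeight.raise_topMonomial (hv : IsRegularHighestWeight ε d p E lam v)
    (hE : IsColorMatrixUnits ε d E) (K : Fin m) {l : List {j : Fin m // j < K}}
    {i b : Fin m} (hl : ∀ j ∈ l, i < j.1) (hib : i < b) (hb : b ≤ K) :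
    E i b • topMonomial (lowerRow E K) (rowExp ε d p K) l • v = 0 := by
  induction l generalizing b with
  | nil => simpa using hv.raise i b hib
  | cons j l ih =>
    have hl' : ∀ j ∈ l, i < j.1 := fun j hj => hl j (List.mem_cons_of_mem _ hj)
    have hij : i < j.1 := hl j (by simp)
    set w := topMonomial (lowerRow E K) (rowExp ε d p K) l • v with hw
    have key : ∀ n : ℕ, ∀ b : Fin m, i < b → b ≤ K → E i b • (E K j.1) ^ n • w = 0 := by
      intro n
      induction n with
      | zero => intro b h1 h2; rw [pow_zero, one_smul]; exact ih hl' h1 h2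
      | succ n ihn =>
        intro b h1 h2
        rw [pow_succ', mul_smul, hE.smul_smul_eq, ihn b h1 h2, smul_zero, smul_zero, zero_add,
          if_neg hij.ne', smul_zero, sub_zero]
        split_ifs
        · exact ihn j.1 hij j.2.le
        · rfl
    rw [topMonomial_cons, mul_smul]
    exact key _ b hib hb

/-- Raising operators lead back from the top monomial of a row to the highest weight vector. -/
theorem IsRegularHighestWeight.exists_smul_topMonomial_eq
    (hv : IsRegularHighestWeight ε d p E lam v) [hp : Fact p.Prime] [CharP F p]
    (hE : IsColorMatrixUnits ε d E) (K : Fin m)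
    {l : List {j : Fin m // j < K}} (hl : l.Pairwise (· < ·)) :
    ∃ u ∈ leviAlgebra F E (K.val + 1),
      u • topMonomial (lowerRow E K) (rowExp ε d p K) l • v = v := by
  induction l with
  | nil => exact ⟨1, one_mem _, by simp⟩
  | cons j l ih =>
    obtain ⟨hj, hl⟩ := List.pairwise_cons.mp hl
    obtain ⟨u, huU, hu⟩ := ih hl
    set w := topMonomial (lowerRow E K) (rowExp ε d p K) l • v with hw
    obtain ⟨n1, hn1⟩ := hv.weight_topMonomial hE K l j.1
    obtain ⟨n2, hn2⟩ := hv.weight_topMonomial hE K l K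
    rw [← hw] at hn1 hn2
    have he : E j.1 K • w = 0 := hv.raise_topMonomial hE K (fun i hi => hj i hi) j.2 le_rfl
    have hjK : j.1 ≠ K := j.2.ne
    suffices ∃ c : F, c ≠ 0 ∧ E j.1 K ^ rowExp ε d p K j • E K j.1 ^ rowExp ε d p K j • w = c • w by
      obtain ⟨c, hc, h⟩ := this
      refine ⟨c⁻¹ • (u * E j.1 K ^ rowExp ε d p K j), Subalgebra.smul_mem _ (mul_mem huU
        (pow_mem (mem_leviAlgebra (Or.inr ⟨Nat.lt_succ_of_lt j.2, Nat.lt_succ_self _⟩)) _)) _, ?_⟩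
      rw [topMonomial_cons, mul_smul (lowerRow E K j ^ _), smul_assoc, mul_smul u, lowerRow, ← hw,
        h, smul_comm u c, smul_smul, inv_mul_cancel₀ hc, one_smul, hu]
    -- The sign in the bracket of the opposite root vectors is `(γ, γ) = ±1` for `γ = d K - d j`, so
    -- the parity alone decides between a commutator and an anticommutator.
    have hsign : ε.val (d j.1 - d K) (d K - d j.1) = ε.val (d K - d j.1) (d K - d j.1) := by
      rw [← neg_sub, ε.val_neg_left]
    have hef := hE j.1 K K j.1
    rw [if_pos rfl, if_pos rfl, hsign] at hef
    have hneg : ε.IsEven (d j.1 - d K) ↔ ε.IsEven (d K - d j.1) := by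
      rw [← ε.isEven_neg, neg_sub]
    rw [rowExp, topExp]
    split_ifs with heven
    · rw [show ε.val (d K - d j.1) (d K - d j.1) = 1 from heven, one_smul, one_smul] at hef
      refine exists_pow_smul_pow_smul_of_sl2 p (μ := (lam j.1 + n1) - (lam K + n2)) hef ?_ he ?_ ?_
        (Nat.sub_lt hp.out.pos one_pos)
      · have h1 := hE j.1 j.1 K j.1
        have h2 := hE K K K j.1
        rw [sub_self, ε.val_zero_left, if_neg hjK, if_pos rfl] at h1
        rw [sub_self, ε.val_zero_left, if_pos rfl, if_neg hjK] at h2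
        rw [sub_mul, h1, h2, two_smul]
        simp only [one_smul, mul_sub]
        abel
      · rw [sub_smul, hn1, hn2, ← sub_smul]
      · intro n hn
        refine hv.even j.1 K j.2 (hneg.mpr heven) (n - n1 + n2) ?_
        push_cast
        linear_combination hn
    -- For an odd root the maximal exponent is `1` and `e f = -f e + h_j + h_K`, so `e f w` is the
    -- value of the coroot times `w`.
    · rw [ε.val_self_of_not_isEven heven] at hef
      refine ⟨(lam j.1 + n1) + (lam K + n2), ?_, ?_⟩
      · intro hn
        refine hv.odd j.1 K j.2 (hneg.not.mpr heven) (- n1 - n2) ?_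
        push_cast
        linear_combination hn
      · rw [pow_one, pow_one, ← mul_smul, hef, add_smul, sub_smul, smul_assoc, mul_smul, he, hn1,
          smul_assoc, hn2]
        simp only [smul_zero, zero_add]
        rw [neg_one_smul, sub_neg_eq_add, ← add_smul]

/-- The Levi subalgebra generated by the first matrix units is moved past the top monomial of the
next row. -/
theorem IsColorMatrixUnits.exists_topMonomial_mul (hE : IsColorMatrixUnits ε d E) {K : Fin m}
    {t : {j : Fin m // j < K} → ℕ} (ht : ∀ j, lowerRow E K j ^ (t j + 1) = 0)
    {l : List {j : Fin m // j < K}} (hnd : l.Nodup) (hl : ∀ j, j ∈ l) {u : A}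
    (hu : u ∈ leviAlgebra F E K.val) :
    ∃ u' ∈ leviAlgebra F E K.val, topMonomial (lowerRow E K) t l * u
      = u' * topMonomial (lowerRow E K) t l := by
  induction hu using Algebra.adjoin_induction with
  | mem a ha =>
    obtain ⟨i, j, hij, rfl⟩ := ha
    have hmem : E i j ∈ leviAlgebra F E K.val := mem_leviAlgebra hij
    by_cases h : i = j
    · subst h
      obtain ⟨n, hn⟩ := exists_mul_topMonomial_of_mul_eq_add_smul (F := F) (x := lowerRow E K)
        (a := E i i) (fun j => hE.diag_mul i K j.1) t l
      refine ⟨E i i - algebraMap F A n, sub_mem hmem (Subalgebra.algebraMap_mem _ _), ?_⟩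
      rw [sub_mul, hn, ← Algebra.smul_def, add_sub_cancel_right]
    · obtain ⟨hi, hj⟩ := hij.resolve_left h
      -- Within row `K`, the operator `E i j` color-commutes with everything except `E K i`, which
      -- it turns into a multiple of `E K j`.
      obtain ⟨c, hc, hcomm⟩ := exists_mul_topMonomial_of_replace (F := F) (x := lowerRow E K)
        (t := t) (a := E i j) (i := ⟨i, hi⟩) (j := ⟨j, hj⟩) (by simpa using h)
        (hE.lowerRow_quasiCommute K) ht
        (fun k hk => hE.quasiCommute (ne_of_lt hj) fun h => hk (Subtype.ext h))
        ⟨_, ε.val_ne_zero (d i - d j) (d K - d i), -ε.val (d i - d j) (d K - d i), by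
          have h1 := hE i j K i
          rw [if_neg (show j ≠ K from ne_of_lt hj), if_pos rfl, zero_sub, ← neg_smul] at h1
          exact h1⟩ hnd (hl ⟨j, hj⟩)
      refine ⟨c⁻¹ • E i j, Subalgebra.smul_mem _ hmem _, ?_⟩
      rw [smul_mul_assoc, hcomm, smul_smul, inv_mul_cancel₀ hc, one_smul]
  | algebraMap r =>
    exact ⟨_, Subalgebra.algebraMap_mem _ r, (Algebra.commutes r _).symm⟩
  | add x y _ _ hx hy =>
    obtain ⟨x', hx', hx⟩ := hx
    obtain ⟨y', hy', hy⟩ := hy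
    exact ⟨x' + y', add_mem hx' hy', by rw [mul_add, hx, hy, add_mul]⟩
  | mul x y _ _ hx hy =>
    obtain ⟨x', hx', hx⟩ := hx
    obtain ⟨y', hy', hy⟩ := hy
    exact ⟨x' * y', mul_mem hx' hy', by rw [← mul_assoc, hx, mul_assoc, hy, mul_assoc]⟩

/-- With `X` the top monomial of the last row, the four ingredients are `u1 w = X w'`, `u2 w' = v`,
`X u2 = u3 X` and `u4 X v = v`. They combine to `u4 u3 u1 w = u4 X u2 w' = v`. At level `0` the
orbit is the line through `v`. -/
theorem IsRegularHighestWeight.exists_smul_eq_of_mem_orbit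
    (hv : IsRegularHighestWeight ε d p E lam v) [Fact p.Prime] [CharP F p]
    (hE : IsColorMatrixUnits ε d E) {k : ℕ} (hk : k ≤ m) {w : Z}
    (hw : w ∈ orbit (leviAlgebra F E k) v) (hw0 : w ≠ 0) :
    ∃ u ∈ leviAlgebra F E k, u • w = v := by
  induction k generalizing w with
  | zero =>
    have hline : ∀ u ∈ leviAlgebra F E 0, ∃ c : F, u • v = c • v := by
      intro u hu
      induction hu using Algebra.adjoin_induction with
      | mem a ha =>
        obtain ⟨i, j, hij, rfl⟩ := ha
        obtain rfl : i = j := hij.resolve_right (by simp)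
        exact ⟨_, hv.weight i⟩
      | algebraMap r => exact ⟨r, algebraMap_smul _ _ _⟩
      | add x y _ _ hx hy =>
        obtain ⟨a, ha⟩ := hx
        obtain ⟨b, hb⟩ := hy
        exact ⟨a + b, by rw [add_smul, ha, hb, add_smul]⟩
      | mul x y _ _ hx hy =>
        obtain ⟨a, ha⟩ := hx
        obtain ⟨b, hb⟩ := hy
        exact ⟨b * a, by rw [mul_smul, hb, smul_comm, ha, smul_smul]⟩
    obtain ⟨u, hu, rfl⟩ := mem_orbit.mp hw
    obtain ⟨c, hc⟩ := hline u hu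
    have hc0 : c ≠ 0 := by rintro rfl; exact hw0 (by rw [hc, zero_smul])
    exact ⟨algebraMap F A c⁻¹, Subalgebra.algebraMap_mem _ _, by
      rw [hc, algebraMap_smul, smul_smul, inv_mul_cancel₀ hc0, one_smul]⟩
  | succ k ih =>
    let K : Fin m := ⟨k, hk⟩
    -- The increasing order matters only for raising `X v` back to `v`.
    let l : List {j : Fin m // j < K} := (Finset.univ : Finset {j : Fin m // j < K}).sort (· ≤ ·)
    have hl : ∀ j, j ∈ l := fun j => (Finset.mem_sort _).mpr (Finset.mem_univ _)
    have hnd : l.Nodup := Finset.sort_nodup _ _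
    have hsorted : l.Pairwise (· < ·) := (Finset.sortedLT_sort _).pairwise
    have ht : ∀ j, lowerRow E K j ^ (rowExp ε d p K j + 1) = 0 :=
      fun j => hv.nilpotent K j.1 j.2.ne'
    have hwT := hE.orbit_le_monomialSpan ht hl (fun i hi => hv.raise i K hi) hw
    obtain ⟨u1, hu1, -, w', hw', hw'0, h1⟩ := exists_smul_eq_topMonomial_smul
      (hE.lowerRow_quasiCommute K) ht (U := leviAlgebra F E (k + 1)) (fun j _ => lowerRow_mem j)
      hwT hw0
    obtain ⟨u2, hu2, h2⟩ := ih (Nat.le_of_succ_le hk) hw' hw'0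
    obtain ⟨u3, hu3, h3⟩ := hE.exists_topMonomial_mul ht hnd hl hu2
    obtain ⟨u4, hu4, h4⟩ := hv.exists_smul_topMonomial_eq hE K hsorted
    refine ⟨u4 * (u3 * u1), mul_mem hu4 (mul_mem (leviAlgebra_mono (Nat.le_succ k) hu3) hu1), ?_⟩
    rw [mul_smul, mul_smul, h1, ← mul_smul u3, ← h3, mul_smul, h2, h4]

/-- A module generated by a regular highest weight vector has no proper nonzero submodules. -/
theorem IsRegularHighestWeight.eq_bot_or_eq_top
    (hv : IsRegularHighestWeight ε d p E lam v) [Fact p.Prime] [CharP F p]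
    (hE : IsColorMatrixUnits ε d E) (hgen : Algebra.adjoin F {a | ∃ i j, a = E i j} = ⊤)
    (hcyc : ∀ z : Z, ∃ a : A, a • v = z) (N : Submodule A Z) : N = ⊥ ∨ N = ⊤ := by
  have htop : leviAlgebra F E m = ⊤ := by
    rw [eq_top_iff, ← hgen]
    refine Algebra.adjoin_mono ?_
    rintro _ ⟨i, j, rfl⟩
    exact ⟨i, j, Or.inr ⟨i.2, j.2⟩, rfl⟩
  refine or_iff_not_imp_left.mpr fun hN => ?_
  obtain ⟨w, hwN, hw0⟩ := N.ne_bot_iff.mp hN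
  obtain ⟨a, ha⟩ := hcyc w
  obtain ⟨u, -, hu⟩ := hv.exists_smul_eq_of_mem_orbit hE le_rfl
    (mem_orbit.mpr ⟨a, by rw [htop]; trivial, ha⟩) hw0
  have hvN : v ∈ N := hu ▸ N.smul_mem u hwN
  rw [eq_top_iff]
  intro z _
  obtain ⟨b, rfl⟩ := hcyc z
  exact N.smul_mem b hvN

end Simplicity

/-! ### Jacobson's formula -/

section Jacobson

variable {F : Type*} [Field F] {p : ℕ} [hp : Fact p.Prime] [CharP F p]

theorem choose_prime_sub_one {i : ℕ} (hi : i < p) : ((p - 1).choose i : F) = (-1) ^ i := by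
  induction i with
  | zero => simp
  | succ i ih =>
    have h1 : (p.choose (i + 1) : F) = 0 :=
      (CharP.cast_eq_zero_iff F p _).mpr (hp.out.dvd_choose_self (by omega) hi)
    obtain ⟨q, hq⟩ : ∃ q, p = q + 1 := ⟨p - 1, by have := hp.out.pos; omega⟩
    rw [hq, Nat.choose_succ_succ, Nat.cast_add] at h1
    rw [show p - 1 = q by omega] at ih ⊢
    rw [pow_succ, ← ih (by omega)]
    linear_combination h1

variable {C : Type*} [Ring C] [Algebra F C]

/-- Left and right multiplication by `a` commute, so the power of their difference expands
binomially. Since `(p - 1).choose i = (-1) ^ i` in `F` and `p - 1` is even, all signs cancel. -/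
theorem sum_pow_mul_pow_eq_ad_pow (hodd : Odd p) (a b : C) :
    ∑ i ∈ Finset.range p, a ^ i * b * a ^ (p - 1 - i)
      = ((LinearMap.mulLeft F a - LinearMap.mulRight F a) ^ (p - 1)) b := by
  have hpos := hp.out.pos
  rw [sub_eq_add_neg, (Commute.neg_right (LinearMap.commute_mulLeft_right (R := F) a a)).add_pow,
    show p - 1 + 1 = p by omega, LinearMap.sum_apply]
  refine Finset.sum_congr rfl fun i hi => ?_
  have hi := Finset.mem_range.mp hi
  have hsign : ((-1) ^ (p - 1 - i) * (-1) ^ i : F) = 1 := by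
    rw [← pow_add, show p - 1 - i + i = p - 1 by omega]
    exact (Nat.Odd.sub_odd hodd odd_one).neg_one_pow
  have h1 : ((-1) ^ (p - 1 - i) : Module.End F C) = algebraMap F _ ((-1) ^ (p - 1 - i)) := by simp
  rw [neg_pow, h1, ← map_natCast (algebraMap F (Module.End F C)), choose_prime_sub_one hi,
    LinearMap.pow_mulLeft, LinearMap.pow_mulRight]
  simp only [Module.End.mul_apply, Module.algebraMap_end_apply, LinearMap.mulLeft_apply,
    LinearMap.mulRight_apply, smul_mul_assoc, smul_smul, hsign, one_smul, mul_assoc]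

theorem derivative_pow_eq_sum {R : Type*} [Ring R] (P : Polynomial R) (n : ℕ) :
    Polynomial.derivative (P ^ n)
      = ∑ i ∈ Finset.range n, P ^ i * Polynomial.derivative P * P ^ (n - 1 - i) := by
  induction n with
  | zero => simp
  | succ n ih =>
    rw [pow_succ, Polynomial.derivative_mul, ih, Finset.sum_range_succ, Finset.sum_mul]
    simp only [Nat.add_sub_cancel, Nat.sub_self, pow_zero, mul_one]
    congr 1
    refine Finset.sum_congr rfl fun i hi => ?_
    have hi := Finset.mem_range.mp hi
    rw [mul_assoc _ _ P, ← pow_succ, show n - 1 - i + 1 = n - i by omega]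

open Polynomial in
/-- Jacobson's formula: `(x + y)ᵖ - xᵖ - yᵖ` is a combination of commutators. -/
theorem add_pow_prime_sub_mem (hodd : Odd p) {L : Submodule F C} {x y : C} (hy : y ∈ L)
    (hxL : ∀ z ∈ L, x * z - z * x ∈ L) (hyL : ∀ z ∈ L, y * z - z * y ∈ L) :
    (x + y) ^ p - x ^ p - y ^ p ∈ L := by
  have hpos := hp.out.pos
  -- `P ^ p` has extreme coefficients `x ^ p` and `y ^ p`, and its value at `1` is `(x + y) ^ p`.
  -- Its derivative is `ad(P)^(p-1)` applied to `y`, with coefficients in `L`; the coefficient of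
  -- degree `n + 1 < p` is recovered on dividing by `n + 1`.
  set P : C[X] := Polynomial.C x + X * Polynomial.C y with hP
  have hder : derivative P = Polynomial.C y := by simp [hP]
  have had : ∀ Q : C[X], (∀ n, Q.coeff n ∈ L) → ∀ n, (P * Q - Q * P).coeff n ∈ L := by
    intro Q hQ n
    have hX : P * Q - Q * P = (Polynomial.C x * Q - Q * Polynomial.C x)
        + X * (Polynomial.C y * Q - Q * Polynomial.C y) := by
      rw [hP, add_mul, mul_add, ← mul_assoc Q X, ← X_mul, mul_sub]
      simp only [mul_assoc]
      abel
    rw [hX, coeff_add]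
    refine add_mem ?_ ?_
    · rw [coeff_sub, coeff_C_mul, coeff_mul_C]; exact hxL _ (hQ n)
    · cases n with
      | zero => simp
      | succ n => rw [coeff_X_mul, coeff_sub, coeff_C_mul, coeff_mul_C]; exact hyL _ (hQ n)
  have hadpow : ∀ k n, (((LinearMap.mulLeft F P - LinearMap.mulRight F P) ^ k)
      (Polynomial.C y)).coeff n ∈ L := by
    intro k
    induction k with
    | zero =>
      intro n
      rw [pow_zero, Module.End.one_apply, coeff_C]
      split_ifs
      exacts [hy, zero_mem _]
    | succ k ih => rw [pow_succ', Module.End.mul_apply]; exact had _ ih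
  have hcoeff : ∀ n, n + 1 < p → (P ^ p).coeff (n + 1) ∈ L := by
    intro n hn
    have h := hadpow (p - 1) n
    rw [← sum_pow_mul_pow_eq_ad_pow hodd, ← hder, ← derivative_pow_eq_sum, coeff_derivative] at h
    have hn0 : ((n : F) + 1) ≠ 0 := by
      have := (CharP.cast_eq_zero_iff F p (n + 1)).not.mpr (Nat.not_dvd_of_pos_of_lt (by omega) hn)
      exact_mod_cast this
    have h2 : (P ^ p).coeff (n + 1) * ((n : C) + 1) = ((n : F) + 1) • (P ^ p).coeff (n + 1) := by
      rw [Algebra.smul_def, map_add, map_natCast, map_one, ← Nat.cast_succ, Nat.cast_comm]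
    rw [h2] at h
    simpa [smul_smul, inv_mul_cancel₀ hn0] using L.smul_mem ((n : F) + 1)⁻¹ h
  have hdeg1 : P.natDegree ≤ 1 := by
    refine (natDegree_add_le _ _).trans (max_le (by simp) ?_)
    exact natDegree_mul_le.trans (by simpa using natDegree_X_le)
  have hdeg : (P ^ p).natDegree < p + 1 := by
    have := natDegree_pow_le_of_le p hdeg1
    omega
  have h0 : (P ^ p).coeff 0 = x ^ p := by
    have := map_pow (constantCoeff (R := C)) P p
    simpa [hP] using this
  have hpc : (P ^ p).coeff p = y ^ p := by
    have := coeff_pow_of_natDegree_le (m := p) hdeg1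
    rw [mul_one] at this
    rw [this]; simp [hP, coeff_C]
  have heval : (x + y) ^ p = ∑ n ∈ Finset.range (p + 1), (P ^ p).coeff n := by
    have h1 : (eval₂RingHom' (RingHom.id C) 1 fun a => Commute.one_right _) (P ^ p)
        = (x + y) ^ p := by
      rw [map_pow]; simp [hP]
    rw [← h1]
    simp only [eval₂RingHom', RingHom.coe_mk, MonoidHom.coe_mk, OneHom.coe_mk]
    rw [eval₂_eq_sum_range' _ hdeg]
    simp
  obtain ⟨q, hq⟩ : ∃ q, p = q + 1 := ⟨p - 1, by omega⟩
  rw [heval, Finset.sum_range_succ, hpc, add_sub_right_comm, add_sub_cancel_right]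
  rw [show Finset.range p = Finset.range (q + 1) by rw [hq], Finset.sum_range_succ', h0,
    add_sub_cancel_right]
  refine sum_mem fun n hn => hcoeff n ?_
  have := Finset.mem_range.mp hn
  omega

end Jacobson

/-! ### Representations defined by matrix units -/

section Representation

variable {F : Type*} [Field F] {Γ : Type*} [AddCommGroup Γ] {m : ℕ}
variable {A : Type*} [Ring A] [Algebra F A]

/-- The linear map that sends the matrix units to given elements. -/
def ofUnits (F : Type*) [Field F] [Algebra F A] (E : Fin m → Fin m → A) :
    Matrix (Fin m) (Fin m) F →ₗ[F] A where
  toFun x := ∑ i, ∑ j, x i j • E i j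
  map_add' x y := by simp [add_smul, Finset.sum_add_distrib]
  map_smul' c x := by simp [mul_smul, Finset.smul_sum]

theorem ofUnits_single (E : Fin m → Fin m → A) (i j : Fin m) (c : F) :
    ofUnits F E (Matrix.single i j c) = c • E i j := by
  change ∑ i', ∑ j', Matrix.single i j c i' j' • E i' j' = c • E i j
  rw [Finset.sum_eq_single i, Finset.sum_eq_single j]
  · simp
  · intro b _ hb; simp [Matrix.single, hb.symm]
  · simp
  · intro b _ hb; simp [Matrix.single, hb.symm]
  · simp

theorem single_mem_glGr {d : Fin m → Γ} {α : Γ} {i j : Fin m} (h : d i = d j + α) (c : F) :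
    Matrix.single i j c ∈ glGr d α := by
  intro i' j' h'
  by_cases hij : i = i' ∧ j = j'
  · rw [← hij.1, ← hij.2, h]
  · exact absurd (by simp [Matrix.single, hij]) h'

/-- A homogeneous component of `gl(m, Γ)` is spanned by matrix units. -/
theorem glGr_le {d : Fin m → Γ} {α : Γ} {P : Submodule F (Matrix (Fin m) (Fin m) F)}
    (h : ∀ i j, d i = d j + α → Matrix.single i j 1 ∈ P) : glGr d α ≤ P := by
  intro x hx
  rw [Matrix.matrix_eq_sum_single x]
  refine sum_mem fun i _ => sum_mem fun j _ => ?_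
  by_cases hij : x i j = 0
  · rw [hij, Matrix.single_zero]; exact zero_mem _
  · have := P.smul_mem (x i j) (h i j (hx i j hij))
    simpa using this

variable {ε : Bicharacter F Γ} {d : Fin m → Γ} {E : Fin m → Fin m → A}

/-- Once `α` and `β` are fixed, the scalar in the bracket is constant and the defect `B` is
bilinear, so it can be tested on the matrix units that span the two components. -/
theorem IsColorMatrixUnits.ofUnits_bracket (hE : IsColorMatrixUnits ε d E) {α β : Γ}
    {x y : Matrix (Fin m) (Fin m) F} (hx : x ∈ glGr d α) (hy : y ∈ glGr d β) :
    ofUnits F E x * ofUnits F E y - ε.val α β • (ofUnits F E y * ofUnits F E x)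
      = ofUnits F E (colorBracket ε α β x y) := by
  let M := Matrix (Fin m) (Fin m) F
  let B : M →ₗ[F] M →ₗ[F] A :=
    (LinearMap.mul F A).compl₁₂ (ofUnits F E) (ofUnits F E)
      - ε.val α β • ((LinearMap.mul F A).compl₁₂ (ofUnits F E) (ofUnits F E)).flip
      - (LinearMap.mul F M - ε.val α β • (LinearMap.mul F M).flip).compr₂ (ofUnits F E)
  have hB : ∀ x y, B x y = ofUnits F E x * ofUnits F E y
      - ε.val α β • (ofUnits F E y * ofUnits F E x) - ofUnits F E (colorBracket ε α β x y) := by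
    intro x y
    simp [B, colorBracket]
  suffices B x y = 0 by rwa [hB, sub_eq_zero] at this
  have h1 : glGr d β ≤ LinearMap.ker (B x) := by
    refine glGr_le fun k l hkl => ?_
    have h2 : glGr d α ≤ LinearMap.ker (B.flip (Matrix.single k l 1)) := by
      refine glGr_le fun i j hij => ?_
      rw [LinearMap.mem_ker, LinearMap.flip_apply, hB, colorBracket, map_sub, map_smul]
      simp only [ofUnits_single, one_smul]
      rw [hE i j k l, show d i - d j = α by rw [hij]; abel, show d k - d l = β by rw [hkl]; abel]
      have h3 : ∀ i j k l : Fin m, ofUnits F E (Matrix.single i j 1 * Matrix.single k l 1)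
          = if j = k then E i l else 0 := by
        intro i j k l
        split_ifs with h
        · rw [h, Matrix.single_mul_single_same, ofUnits_single]; simp
        · rw [Matrix.single_mul_single_of_ne _ _ _ _ h, map_zero]
      rw [h3, h3]
      abel
    exact h2 hx
  exact h1 hy

theorem single_one_pow {p : ℕ} (hp : 1 < p) (i j : Fin m) :
    (Matrix.single i j 1 : Matrix (Fin m) (Fin m) F) ^ p
      = if i = j then Matrix.single i j 1 else 0 := by
  obtain ⟨q, rfl⟩ : ∃ q, p = q + 2 := ⟨p - 2, by omega⟩
  split_ifs with hij
  · subst hij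
    exact IsIdempotentElem.pow_succ_eq (q + 1) (by
      rw [IsIdempotentElem, Matrix.single_mul_single_same, mul_one])
  · rw [pow_add, pow_two, Matrix.single_mul_single_of_ne _ _ _ _ (Ne.symm hij), mul_zero]

theorem mul_mem_glGr {d : Fin m → Γ} {α β : Γ} {x y : Matrix (Fin m) (Fin m) F}
    (hx : x ∈ glGr d α) (hy : y ∈ glGr d β) : x * y ∈ glGr d (α + β) := by
  intro i j h
  rw [Matrix.mul_apply] at h
  obtain ⟨k, -, hk⟩ := Finset.exists_ne_zero_of_sum_ne_zero h
  rw [hx i k (left_ne_zero_of_mul hk), hy k j (right_ne_zero_of_mul hk)]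
  abel

/-- The `p`-map relation for homogeneous elements of even degree follows from that for matrix
units. -/
theorem IsColorMatrixUnits.ofUnits_pow (hE : IsColorMatrixUnits ε d E) {p : ℕ}
    [hp : Fact p.Prime] [CharP F p] (hodd : Odd p) {χ : Module.Dual F (Matrix (Fin m) (Fin m) F)}
    (hpow : ∀ i j, ε.IsEven (d i - d j) → E i j ^ p - (if i = j then E i j else 0)
      = algebraMap F A (χ (Matrix.single i j 1) ^ p))
    {α : Γ} (hα : ε.IsEven α) {x : Matrix (Fin m) (Fin m) F} (hx : x ∈ glGr d α) :
    ofUnits F E x ^ p - ofUnits F E (x ^ p) = algebraMap F A (χ x ^ p) := by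
  set ρ := ofUnits F E with hρ
  have hp1 : 1 < p := hp.out.one_lt
  have hval : ∀ k : ℕ, ε.val α (k • α) = 1 := by
    intro k
    induction k with
    | zero => rw [zero_smul, ε.val_zero_right]
    | succ k ih => rw [succ_nsmul, ε.val_add_right, ih, one_mul]; exact hα
  -- Jacobson's formula is applied in the product ring, to points of the graph of `ρ`. Since `(α,
  -- kα) = 1`, the color bracket of degrees `α` and `kα` is the ordinary commutator, so `L` is
  -- stable under commutators with `(x, ρ x)`. As `L` lies in the graph, the two Jacobson
  -- corrections correspond under `ρ`, and `ρ x ^ p - ρ (x ^ p)` is additive on the component.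
  let L : Submodule F (Matrix (Fin m) (Fin m) F × A) :=
    Submodule.span F {z | ∃ k : ℕ, z.1 ∈ glGr d (k • α) ∧ z.2 = ρ z.1}
  have hLgraph : ∀ z ∈ L, z.2 = ρ z.1 := by
    intro z hz
    induction hz using Submodule.span_induction with
    | mem z hz => exact hz.choose_spec.2
    | zero => simp
    | add z w _ _ hz hw => simp [hz, hw]
    | smul c z _ hz => simp [hz]
  have hLx : ∀ x ∈ glGr d α, ∀ z ∈ L, (x, ρ x) * z - z * (x, ρ x) ∈ L := by
    intro x hx z hz
    induction hz using Submodule.span_induction with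
    | mem z hz =>
      obtain ⟨k, hz1, hz2⟩ := hz
      refine Submodule.subset_span ⟨k + 1, ?_, ?_⟩
      · rw [succ_nsmul]
        exact sub_mem (add_comm α (k • α) ▸ mul_mem_glGr hx hz1) (mul_mem_glGr hz1 hx)
      · have h := hE.ofUnits_bracket hx hz1
        rw [colorBracket, hval, one_smul, one_smul] at h
        change ρ x * z.2 - z.2 * ρ x = ρ (x * z.1 - z.1 * x)
        rw [hz2, h]
    | zero => simp
    | add z w _ _ hz hw =>
      rw [mul_add, add_mul, add_sub_add_comm]
      exact add_mem hz hw
    | smul c z _ hz =>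
      rw [mul_smul_comm, smul_mul_assoc, ← smul_sub]
      exact Submodule.smul_mem _ _ hz
  have hmem : ∀ x ∈ glGr d α, (x, ρ x) ∈ L := fun x hx =>
    Submodule.subset_span ⟨1, by rwa [one_smul], rfl⟩
  have hadd : ∀ x ∈ glGr d α, ∀ y ∈ glGr d α, ρ (x + y) ^ p - ρ ((x + y) ^ p)
      = (ρ x ^ p - ρ (x ^ p)) + (ρ y ^ p - ρ (y ^ p)) := by
    intro x hx y hy
    have h := hLgraph _ (add_pow_prime_sub_mem hodd (hmem y hy) (hLx x hx) (hLx y hy))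
    simp only [Prod.mk_add_mk, Prod.pow_mk, Prod.mk_sub_mk, map_sub, ← map_add] at h
    rw [sub_eq_iff_eq_add, sub_eq_iff_eq_add] at h
    rw [h]
    abel
  let P : Submodule F (Matrix (Fin m) (Fin m) F) :=
    { carrier := {x | x ∈ glGr d α ∧ ρ x ^ p - ρ (x ^ p) = algebraMap F A (χ x ^ p)}
      add_mem' := by
        rintro x y ⟨hx, hx'⟩ ⟨hy, hy'⟩
        refine ⟨add_mem hx hy, ?_⟩
        rw [hadd x hx y hy, hx', hy', map_add, add_pow_char, map_add]
      zero_mem' := ⟨zero_mem _, by simp [hp.out.ne_zero]⟩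
      smul_mem' := by
        rintro c x ⟨hx, hx'⟩
        refine ⟨Submodule.smul_mem _ c hx, ?_⟩
        rw [smul_pow, map_smul, map_smul, smul_pow, ← smul_sub, hx', map_smul, smul_eq_mul, mul_pow,
          map_mul, Algebra.smul_def] }
  have hle : glGr d α ≤ P := by
    refine glGr_le fun i j hij => ⟨single_mem_glGr hij 1, ?_⟩
    rw [single_one_pow hp1, hρ, ofUnits_single, one_smul,
      ← hpow i j (by rwa [show d i - d j = α by rw [hij]; abel])]
    congr 1
    split_ifs
    · rw [ofUnits_single, one_smul]
    · rw [map_zero]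
  exact (hle hx).2

end Representation

/-! ### Color oscillators -/

section Oscillators

variable {F : Type*} [Field F] {Γ : Type*} [AddCommGroup Γ] {I : Type*} [Fintype I]
  [LinearOrder I]

/-- The degree of the part of a state that lies on the sites before `s`. -/
def prefixDegree (g : I → Γ) (s : I) (n : I → ℤ) : Γ :=
  ∑ t ∈ Finset.univ.filter (· < s), n t • g t

theorem prefixDegree_update_of_le {g : I → Γ} {s t : I} (h : t ≤ s) (n : I → ℤ) (k : ℤ) :
    prefixDegree g t (Function.update n s k) = prefixDegree g t n := by
  refine Finset.sum_congr rfl fun u hu => ?_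
  rw [Function.update_of_ne ((Finset.mem_filter.mp hu).2.trans_le h).ne]

theorem prefixDegree_update_of_lt {g : I → Γ} {s t : I} (h : s < t) (n : I → ℤ) (e : ℤ) :
    prefixDegree g t (Function.update n s (n s + e)) = prefixDegree g t n + e • g s := by
  have hs : s ∈ Finset.univ.filter (· < t) := by simpa using h
  rw [prefixDegree, prefixDegree, ← Finset.add_sum_erase _ _ hs, ← Finset.add_sum_erase _ _ hs,
    Function.update_self, add_smul, add_right_comm]
  refine congrArg (fun x => n s • g s + x + e • g s) ?_
  refine Finset.sum_congr rfl fun u hu => ?_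
  rw [Function.update_of_ne (Finset.ne_of_mem_erase hu)]

/-- The operator on functions of states that shifts the occupation number of the site `s` by `e`,
with coefficients `c`. Its degree is `-e • g s`. -/
def siteOp (ε : Bicharacter F Γ) (g : I → Γ) (s : I) (e : ℤ) (c : ℤ → F) :
    Module.End F ((I → ℤ) → F) where
  -- The bicharacter factor is a Jordan–Wigner twist: it makes operators at different sites
  -- color-commute.
  toFun f n := ε.val (-(e • g s)) (prefixDegree g s n) * c (n s)
    * f (Function.update n s (n s + e))
  map_add' f f' := by ext n; simp [mul_add]
  map_smul' r f := by ext n; simp [mul_left_comm]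

theorem siteOp_apply (ε : Bicharacter F Γ) (g : I → Γ) (s : I) (e : ℤ) (c : ℤ → F)
    (f : (I → ℤ) → F) (n : I → ℤ) : siteOp ε g s e c f n
      = ε.val (-(e • g s)) (prefixDegree g s n) * c (n s) * f (Function.update n s (n s + e)) :=
  rfl

/-- Shifting the earlier site changes the prefix degree at the later one by `e • g s`, while a shift
at `t` is invisible at `s`; the commutation factor is the resulting change of twist. -/
theorem siteOp_mul_of_lt (ε : Bicharacter F Γ) (g : I → Γ) {s t : I} (h : s < t) (e e' : ℤ)
    (c c' : ℤ → F) : siteOp ε g s e c * siteOp ε g t e' c'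
      = ε.val (-(e • g s)) (-(e' • g t)) • (siteOp ε g t e' c' * siteOp ε g s e c) := by
  ext f n
  rw [LinearMap.smul_apply, Module.End.mul_apply, Module.End.mul_apply, Pi.smul_apply]
  simp only [siteOp_apply]
  rw [prefixDegree_update_of_lt h, prefixDegree_update_of_le h.le,
    Function.update_of_ne h.ne', Function.update_of_ne h.ne, Function.update_comm h.ne,
    ε.val_add_right, ε.val_neg_left _ (-(e' • g t)), ← ε.val_neg_right, neg_neg, smul_eq_mul]
  ring

theorem siteOp_mul_of_ne (ε : Bicharacter F Γ) (g : I → Γ) {s t : I} (h : s ≠ t) (e e' : ℤ)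
    (c c' : ℤ → F) : siteOp ε g s e c * siteOp ε g t e' c'
      = ε.val (-(e • g s)) (-(e' • g t)) • (siteOp ε g t e' c' * siteOp ε g s e c) := by
  rcases lt_or_gt_of_ne h with h | h
  · exact siteOp_mul_of_lt ε g h e e' c c'
  · rw [siteOp_mul_of_lt ε g h, smul_smul, ε.val_mul_swap, one_smul]

theorem siteOp_mul_self_apply (ε : Bicharacter F Γ) (g : I → Γ) (s : I) (e : ℤ)
    (c c' : ℤ → F) (f : (I → ℤ) → F) (n : I → ℤ) :
    (siteOp ε g s e c * siteOp ε g s (-e) c') f n = c (n s) * c' (n s + e) * f n := by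
  rw [Module.End.mul_apply]
  simp only [siteOp_apply]
  rw [prefixDegree_update_of_le le_rfl, Function.update_self, Function.update_idem,
    add_neg_cancel_right, Function.update_eq_self, neg_smul, neg_neg]
  have h : ε.val (-(e • g s)) (prefixDegree g s n) * ε.val (e • g s) (prefixDegree g s n) = 1 := by
    rw [← ε.val_add_left, neg_add_cancel, ε.val_zero_left]
  linear_combination (c (n s) * c' (n s + e) * f n) * h

theorem siteOp_pow_apply (ε : Bicharacter F Γ) (g : I → Γ) (s : I) (e : ℤ) (c : ℤ → F) (k : ℕ)
    (f : (I → ℤ) → F) (n : I → ℤ) : (siteOp ε g s e c ^ k) f n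
      = ε.val (-(e • g s)) (prefixDegree g s n) ^ k * (∏ r ∈ Finset.range k, c (n s + r * e))
        * f (Function.update n s (n s + k * e)) := by
  induction k generalizing n with
  | zero => simp
  | succ k ih =>
    rw [pow_succ', Module.End.mul_apply, siteOp_apply, ih, prefixDegree_update_of_le le_rfl,
      Function.update_self, Function.update_idem, Finset.prod_range_succ', pow_succ]
    have h1 : ∀ r : ℕ, n s + ((r + 1 : ℕ) : ℤ) * e = n s + e + r * e := by
      intro r; push_cast; ring
    simp only [h1]
    simp only [Nat.cast_zero, zero_mul, add_zero]
    ring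

theorem siteOp_pow_eq_zero (ε : Bicharacter F Γ) (g : I → Γ) (s : I) {e : ℤ} {c : ℤ → F} {k : ℕ}
    (h : ∀ a : ℤ, ∃ r : ℕ, r < k ∧ c (a + r * e) = 0) : siteOp ε g s e c ^ k = 0 := by
  ext f n
  obtain ⟨r, hr, h0⟩ := h (n s)
  rw [siteOp_pow_apply, Finset.prod_eq_zero (Finset.mem_range.mpr hr) h0]
  simp

theorem siteOp_single_eq_zero [DecidableEq (I → ℤ)] (ε : Bicharacter F Γ) (g : I → Γ) (s : I)
    {e : ℤ} {c : ℤ → F} {n : I → ℤ} (h : c (n s - e) = 0) :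
    siteOp ε g s e c (Pi.single n 1) = 0 := by
  ext u
  rw [siteOp_apply, Pi.zero_apply]
  by_cases hu : Function.update u s (u s + e) = n
  · have hs : u s = n s - e := by rw [← hu, Function.update_self]; ring
    rw [hs, h]; ring
  · rw [Pi.single_eq_of_ne hu, mul_zero]

/-- Coefficients `ξ`, `η` for which the operators `siteOp` of shifts `-1` and `1` satisfy the
relations of a boson or of a fermion, according to the parity. -/
structure IsOscillator (even : Prop) (ξ η : ℤ → F) : Prop where
  boson : even → ∀ k, η k * ξ (k + 1) - ξ k * η (k - 1) = 1
  fermion : ¬ even → ∀ k, η k * ξ (k + 1) + ξ k * η (k - 1) = 1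
  fermion_create : ¬ even → ∀ k, ξ k * ξ (k - 1) = 0
  fermion_annihilate : ¬ even → ∀ k, η k * η (k + 1) = 0

variable {ε : Bicharacter F Γ} {g : I → Γ} {ξ η : I → ℤ → F}

theorem create_mul_create (h : ∀ s, IsOscillator (ε.IsEven (g s)) (ξ s) (η s)) (s t : I) :
    siteOp ε g s (-1) (ξ s) * siteOp ε g t (-1) (ξ t)
      = ε.val (g s) (g t) • (siteOp ε g t (-1) (ξ t) * siteOp ε g s (-1) (ξ s)) := by
  by_cases hst : s = t
  · subst hst
    by_cases hs : ε.IsEven (g s)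
    · rw [show ε.val (g s) (g s) = 1 from hs, one_smul]
    · have h0 : siteOp ε g s (-1) (ξ s) * siteOp ε g s (-1) (ξ s) = 0 := by
        rw [← pow_two]
        refine siteOp_pow_eq_zero ε g s fun a => ?_
        rcases mul_eq_zero.mp ((h s).fermion_create hs a) with h0 | h0
        · exact ⟨0, two_pos, by simpa using h0⟩
        · exact ⟨1, one_lt_two, by simpa [← sub_eq_add_neg] using h0⟩
      rw [h0, smul_zero]
  · simpa using siteOp_mul_of_ne ε g hst (-1) (-1) (ξ s) (ξ t)

theorem annihilate_mul_annihilate (h : ∀ s, IsOscillator (ε.IsEven (g s)) (ξ s) (η s))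
    (s t : I) : siteOp ε g s 1 (η s) * siteOp ε g t 1 (η t)
      = ε.val (g s) (g t) • (siteOp ε g t 1 (η t) * siteOp ε g s 1 (η s)) := by
  by_cases hst : s = t
  · subst hst
    by_cases hs : ε.IsEven (g s)
    · rw [show ε.val (g s) (g s) = 1 from hs, one_smul]
    · have h0 : siteOp ε g s 1 (η s) * siteOp ε g s 1 (η s) = 0 := by
        rw [← pow_two]
        refine siteOp_pow_eq_zero ε g s fun a => ?_
        rcases mul_eq_zero.mp ((h s).fermion_annihilate hs a) with h0 | h0
        · exact ⟨0, two_pos, by simpa using h0⟩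
        · exact ⟨1, one_lt_two, by simpa using h0⟩
      rw [h0, smul_zero]
  · have h1 := siteOp_mul_of_ne ε g hst 1 1 (η s) (η t)
    rwa [one_smul, one_smul, ε.val_neg_left, ε.val_neg_left] at h1

theorem annihilate_mul_create (h : ∀ s, IsOscillator (ε.IsEven (g s)) (ξ s) (η s)) (s t : I) :
    siteOp ε g s 1 (η s) * siteOp ε g t (-1) (ξ t)
      = ε.val (g t) (g s) • (siteOp ε g t (-1) (ξ t) * siteOp ε g s 1 (η s))
        + if s = t then 1 else 0 := by
  by_cases hst : s = t
  · subst hst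
    rw [if_pos rfl]
    ext f n
    have h1 := siteOp_mul_self_apply ε g s 1 (η s) (ξ s) f n
    have h2 := siteOp_mul_self_apply ε g s (-1) (ξ s) (η s) f n
    rw [neg_neg] at h2
    rw [h1, LinearMap.add_apply, LinearMap.smul_apply, Pi.add_apply, Pi.smul_apply, h2,
      Module.End.one_apply, smul_eq_mul, ← sub_eq_add_neg]
    by_cases hs : ε.IsEven (g s)
    · rw [show ε.val (g s) (g s) = 1 from hs]
      linear_combination f n * (h s).boson hs (n s)
    · rw [ε.val_self_of_not_isEven hs]
      linear_combination f n * (h s).fermion hs (n s)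
  · have h1 := siteOp_mul_of_ne ε g hst 1 (-1) (η s) (ξ t)
    rw [one_smul, neg_smul, one_smul, neg_neg, ε.val_neg_left] at h1
    rw [if_neg hst, add_zero]
    exact h1

end Oscillators

/-! ### The Jordan–Schwinger realization of `gl(m, Γ)` -/

section JordanSchwinger

variable {F : Type*} [Field F] {Γ : Type*} [AddCommGroup Γ] {m : ℕ}
variable {A : Type*} [Ring A] [Algebra F A]

/-- Color oscillators of degrees `d i - d a`. -/
structure IsColorWeyl (ε : Bicharacter F Γ) (d : Fin m → Γ) (X D : Fin m → Fin m → A) : Prop where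
  create : ∀ i a j b, X i a * X j b = ε.val (d i - d a) (d j - d b) • (X j b * X i a)
  annihilate : ∀ i a j b, D i a * D j b = ε.val (d i - d a) (d j - d b) • (D j b * D i a)
  mixed : ∀ i a j b, D i a * X j b = ε.val (d j - d b) (d i - d a) • (X j b * D i a)
    + if i = j ∧ a = b then 1 else 0

variable {ε : Bicharacter F Γ} {d : Fin m → Γ} {X D : Fin m → Fin m → A}

/-- The contribution of `d a` cancels in the degree of `X i a * D j a`, leaving `d i - d j` for
every `a`. This is what allows the sum over `a` to be homogeneous. -/
theorem IsColorWeyl.term_mul_create (h : IsColorWeyl ε d X D) (i j a k b : Fin m) :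
    X i a * D j a * X k b = ε.val (d i - d j) (d k - d b) • (X k b * (X i a * D j a))
      + if j = k ∧ a = b then X i a else 0 := by
  rw [mul_assoc, h.mixed, mul_add, mul_smul_comm, ← mul_assoc, h.create, smul_mul_assoc, smul_smul,
    mul_assoc]
  congr 1
  · congr 1
    rw [← ε.val_neg_left, ← ε.val_add_left]
    congr 1; abel
  · split_ifs <;> simp

theorem IsColorWeyl.term_mul_annihilate (h : IsColorWeyl ε d X D) (i j a l b : Fin m) :
    X i a * D j a * D l b = ε.val (d i - d j) (d b - d l) • (D l b * (X i a * D j a))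
      - ε.val (d i - d j) (d b - d i) • (if l = i ∧ a = b then D j b else 0) := by
  have h1 := h.mixed l b i a
  have h2 : X i a * D l b = ε.val (d l - d b) (d i - d a) • (D l b * X i a)
      - ε.val (d l - d b) (d i - d a) • (if l = i ∧ b = a then 1 else 0) := by
    rw [h1, smul_add, smul_smul, ε.val_mul_swap, one_smul, add_sub_cancel_right]
  rw [mul_assoc, h.annihilate, mul_smul_comm, ← mul_assoc, h2, sub_mul, smul_sub, smul_mul_assoc,
    smul_smul, smul_mul_assoc, smul_smul, mul_assoc]
  have h3 : ε.val (d j - d a) (d l - d b) * ε.val (d l - d b) (d i - d a)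
      = ε.val (d i - d j) (d b - d l) := by
    rw [← ε.val_neg_left (d i - d a), ← ε.val_add_left,
      show d j - d a + -(d i - d a) = -(d i - d j) by abel, ← neg_sub (d b), ε.val_neg_left,
      ε.val_neg_left]
  rw [h3]
  congr 1
  split_ifs with h4 h5 h5
  · rw [one_mul, ← h4.1, ← h4.2]
  · exact absurd ⟨h4.1, h4.2.symm⟩ h5
  · exact absurd ⟨h5.1, h5.2.symm⟩ h4
  · simp

/-- The Jordan–Schwinger elements `∑ₐ X i a D j a`. -/
def schwinger (X D : Fin m → Fin m → A) (i j : Fin m) : A := ∑ a, X i a * D j a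

/-- The color bracket with `schwinger X D i j` is a color derivation: it replaces `X j b` by `X i b`
and `D i b` by a multiple of `D j b`. Applied to each `X k b * D l b` and summed over `b`, this
yields the matrix unit relations. -/
theorem IsColorWeyl.isColorMatrixUnits (h : IsColorWeyl ε d X D) :
    IsColorMatrixUnits ε d (schwinger X D) := by
  intro i j k l
  have hX : ∀ b, schwinger X D i j * X k b
      = ε.val (d i - d j) (d k - d b) • (X k b * schwinger X D i j)
        + if j = k then X i b else 0 := by
    intro b
    simp only [schwinger, Finset.sum_mul, Finset.mul_sum, h.term_mul_create,
      Finset.sum_add_distrib, Finset.smul_sum]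
    congr 1
    by_cases hjk : j = k <;> simp [hjk]
  have hD : ∀ b, schwinger X D i j * D l b
      = ε.val (d i - d j) (d b - d l) • (D l b * schwinger X D i j)
        - ε.val (d i - d j) (d b - d i) • (if l = i then D j b else 0) := by
    intro b
    simp only [schwinger, Finset.sum_mul, Finset.mul_sum, h.term_mul_annihilate,
      Finset.sum_sub_distrib, Finset.smul_sum]
    congr 1
    by_cases hli : l = i <;> simp [hli]
  have hterm : ∀ b, schwinger X D i j * (X k b * D l b)
      = ε.val (d i - d j) (d k - d l) • (X k b * D l b * schwinger X D i j)
        + ((if j = k then X i b * D l b else 0)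
          - ε.val (d i - d j) (d k - d l) • (if l = i then X k b * D j b else 0)) := by
    intro b
    have hval : ε.val (d i - d j) (d k - d b) * ε.val (d i - d j) (d b - d l)
        = ε.val (d i - d j) (d k - d l) := by
      rw [← ε.val_add_right, sub_add_sub_cancel]
    rw [← mul_assoc, hX, add_mul, smul_mul_assoc, mul_assoc, hD, mul_sub, mul_smul_comm,
      smul_sub, smul_smul, hval, mul_assoc]
    by_cases hli : l = i
    · subst hli
      rw [if_pos rfl, if_pos rfl, mul_smul_comm, smul_smul, hval, ite_mul, zero_mul]
      abel
    · rw [if_neg hli, if_neg hli, ite_mul, zero_mul]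
      simp
  rw [show schwinger X D k l = ∑ b, X k b * D l b from rfl, Finset.mul_sum]
  simp only [hterm, Finset.sum_add_distrib, Finset.sum_sub_distrib, Finset.sum_mul,
    Finset.smul_sum]
  congr 1
  congr 1
  · split_ifs
    · rfl
    · simp
  · split_ifs
    · simp [schwinger, Finset.smul_sum]
    · simp

theorem QuasiCommute.mul_pow_eq {a b : A} (h : QuasiCommute F b a) (n : ℕ) :
    ∃ c : F, (a * b) ^ n = c • (a ^ n * b ^ n) := by
  induction n with
  | zero => exact ⟨1, by simp⟩
  | succ n ih =>
    obtain ⟨c, hc⟩ := ih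
    obtain ⟨r, -, hr⟩ := h.pow_left n
    refine ⟨c * r, ?_⟩
    rw [pow_succ, hc, smul_mul_assoc, mul_assoc, ← mul_assoc (b ^ n), hr, smul_mul_assoc,
      mul_smul_comm, smul_smul, pow_succ, pow_succ]
    simp only [mul_assoc]

theorem sum_pow_prime_of_commute {p : ℕ} [hp : Fact p.Prime] [CharP A p] {ι : Type*}
    (s : Finset ι) (f : ι → A) (h : ∀ i j, Commute (f i) (f j)) :
    (∑ i ∈ s, f i) ^ p = ∑ i ∈ s, f i ^ p := by
  classical
  induction s using Finset.induction_on with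
  | empty => simp [hp.out.ne_zero]
  | insert a s ha ih =>
    rw [Finset.sum_insert ha, Finset.sum_insert ha,
      add_pow_char_of_commute p (Commute.sum_right _ _ _ fun i _ => h a i), ih]

/-- In even degree the summands commute, so the `p`-th power is taken termwise. Each power is a
scalar multiple of `X i a ^ p * D j a ^ p`; the first factor vanishes off the diagonal site, and at
`a = i` the second one does. -/
theorem IsColorWeyl.schwinger_pow_eq_zero (h : IsColorWeyl ε d X D) {p : ℕ} [hp : Fact p.Prime]
    [CharP A p] {i j : Fin m} (hij : i ≠ j) (heven : ε.IsEven (d i - d j))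
    (hX : ∀ a, i ≠ a → X i a ^ p = 0) (hD : D j i ^ p = 0) : schwinger X D i j ^ p = 0 := by
  rw [schwinger, sum_pow_prime_of_commute]
  · refine Finset.sum_eq_zero fun a _ => ?_
    have hq : QuasiCommute F (D j a) (X i a) := by
      refine ⟨_, ε.val_ne_zero (d i - d a) (d j - d a), ?_⟩
      rw [h.mixed, if_neg (fun h' => hij h'.1.symm), add_zero]
    obtain ⟨c, hc⟩ := hq.mul_pow_eq p
    rw [hc]
    by_cases ha : i = a
    · rw [← ha, hD, mul_zero, smul_zero]
    · rw [hX a ha, zero_mul, smul_zero]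
  · intro a b
    rw [Commute, SemiconjBy, ← mul_assoc, h.term_mul_create, if_neg (fun h' => hij h'.1.symm),
      add_zero, smul_mul_assoc, mul_assoc, h.term_mul_annihilate, if_neg (fun h' => hij h'.1.symm),
      smul_zero, sub_zero, mul_smul_comm, smul_smul, ← ε.val_add_right, sub_add_sub_cancel,
      show ε.val (d i - d j) (d i - d j) = 1 from heven, one_smul, mul_assoc]

end JordanSchwinger

/-! ### A highest weight module of arbitrary weight -/

section Model

variable {F : Type*} [Field F] {Γ : Type*} [AddCommGroup Γ] {m : ℕ}

open Classical in
/-- The coefficients of the creation operators: on the diagonal sites the occupation number is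
shifted by `μ`, on the others the operators are nilpotent. -/
def createCoeff (ε : Bicharacter F Γ) (d : Fin m → Γ) (μ : Fin m → F) (i a : Fin m) (k : ℤ) : F :=
  if i = a then μ i + k else if ε.IsEven (d i - d a) then k else if Odd k then 1 else 0

open Classical in
/-- The coefficients of the annihilation operators. -/
def annihilateCoeff (ε : Bicharacter F Γ) (d : Fin m → Γ) (i a : Fin m) (k : ℤ) : F :=
  if i = a then 1
  -- Putting zero where `k + 1 = 0` in `F` makes the operator nilpotent without disturbing the boson
  -- relation, because the creation coefficient at `k + 1` vanishes there as well.
  else if ε.IsEven (d i - d a) then (if ((k + 1 : ℤ) : F) = 0 then 0 else 1)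
  else if Even k then 1 else 0

open Classical in
/-- The part of the eigenvalue of the number operator that lies in the prime ring. -/
def numberValue (ε : Bicharacter F Γ) (d : Fin m → Γ) (i a : Fin m) (k : ℤ) : ℤ :=
  if i = a ∨ ε.IsEven (d i - d a) then k else if Odd k then 1 else 0

theorem createCoeff_mul_annihilateCoeff (ε : Bicharacter F Γ) (d : Fin m → Γ) (μ : Fin m → F)
    (i a : Fin m) (k : ℤ) : createCoeff ε d μ i a k * annihilateCoeff ε d i a (k - 1)
      = (if i = a then μ i else 0) + numberValue ε d i a k := by
  unfold createCoeff annihilateCoeff numberValue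
  by_cases hia : i = a
  · simp [hia]
  by_cases he : ε.IsEven (d i - d a)
  · have hk : ((k - 1 + 1 : ℤ) : F) = k := by rw [sub_add_cancel]
    simp only [hia, he, if_false, if_true, or_true, zero_add]
    split_ifs with h
    · rw [← hk, h, zero_mul]
    · rw [mul_one]
  · by_cases hk : Odd k
    · have : Even (k - 1) := hk.sub_odd odd_one
      simp [hia, he, hk, this]
    · simp [hia, he, hk]

theorem isOscillator_coeff (ε : Bicharacter F Γ) (d : Fin m → Γ) (μ : Fin m → F) (i a : Fin m) :
    IsOscillator (ε.IsEven (d i - d a)) (createCoeff ε d μ i a) (annihilateCoeff ε d i a) := by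
  have hshift : ∀ k, annihilateCoeff ε d i a k * createCoeff ε d μ i a (k + 1)
      = (if i = a then μ i else 0) + numberValue ε d i a (k + 1) := by
    intro k
    rw [← createCoeff_mul_annihilateCoeff, add_sub_cancel_right, mul_comm]
  -- Diagonal sites have degree `0` and are bosonic, so the shift by `μ i` leaves the difference of
  -- number values unchanged.
  have hodd : ¬ ε.IsEven (d i - d a) → i ≠ a := by
    rintro h rfl
    exact h (by rw [sub_self]; exact ε.isEven_zero)
  refine ⟨fun h k => ?_, fun h k => ?_, fun h k => ?_, fun h k => ?_⟩
  · rw [hshift, createCoeff_mul_annihilateCoeff, numberValue, numberValue, if_pos (Or.inr h),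
      if_pos (Or.inr h)]
    push_cast; ring
  · have hia := hodd h
    have hno : ¬ (i = a ∨ ε.IsEven (d i - d a)) := by tauto
    rw [hshift, createCoeff_mul_annihilateCoeff, numberValue, numberValue, if_neg hno, if_neg hno,
      if_neg hia]
    by_cases hk : Odd k
    · have : ¬ Odd (k + 1) := by rw [Int.not_odd_iff_even]; exact hk.add_odd odd_one
      simp [hk, this]
    · have : Odd (k + 1) := by rw [Int.not_odd_iff_even] at hk; exact hk.add_one
      simp [hk, this]
  · simp only [createCoeff, if_neg (hodd h), if_neg h]
    by_cases hk : Odd k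
    · have : ¬ Odd (k - 1) := by rw [Int.not_odd_iff_even]; exact hk.sub_odd odd_one
      simp [this]
    · simp [hk]
  · simp only [annihilateCoeff, if_neg (hodd h), if_neg h]
    by_cases hk : Even k
    · have : ¬ Even (k + 1) := by rw [Int.not_even_iff_odd]; exact hk.add_one
      simp [this]
    · simp [hk]

/-- The space of functions of the occupation numbers of `m × m` oscillators. -/
abbrev Fock (F : Type*) (m : ℕ) : Type _ := (Fin m ×ₗ Fin m → ℤ) → F

/-- The degree of the oscillator at a site. -/
def siteDegree (d : Fin m → Γ) (s : Fin m ×ₗ Fin m) : Γ := d (ofLex s).1 - d (ofLex s).2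

/-- The creation operators. -/
def create (ε : Bicharacter F Γ) (d : Fin m → Γ) (μ : Fin m → F) (i a : Fin m) :
    Module.End F (Fock F m) :=
  siteOp ε (siteDegree d) (toLex (i, a)) (-1) (createCoeff ε d μ i a)

/-- The annihilation operators. -/
def annihilate (ε : Bicharacter F Γ) (d : Fin m → Γ) (i a : Fin m) :
    Module.End F (Fock F m) :=
  siteOp ε (siteDegree d) (toLex (i, a)) 1 (annihilateCoeff ε d i a)

theorem isColorWeyl_fock (ε : Bicharacter F Γ) (d : Fin m → Γ) (μ : Fin m → F) :
    IsColorWeyl ε d (create ε d μ) (annihilate ε d) := by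
  have hosc : ∀ s : Fin m ×ₗ Fin m, IsOscillator (ε.IsEven (siteDegree d s))
      (createCoeff ε d μ (ofLex s).1 (ofLex s).2) (annihilateCoeff ε d (ofLex s).1 (ofLex s).2) :=
    fun s => isOscillator_coeff ε d μ _ _
  refine ⟨fun i a j b => create_mul_create hosc (toLex (i, a)) (toLex (j, b)),
    fun i a j b => annihilate_mul_annihilate hosc (toLex (i, a)) (toLex (j, b)),
    fun i a j b => (annihilate_mul_create hosc (toLex (i, a)) (toLex (j, b))).trans ?_⟩
  congr 1
  simp

/-- The operators of the matrix units on the Fock space. -/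
def fockUnit (ε : Bicharacter F Γ) (d : Fin m → Γ) (μ : Fin m → F) (i j : Fin m) :
    Module.End F (Fock F m) := schwinger (create ε d μ) (annihilate ε d) i j

theorem isColorMatrixUnits_fock (ε : Bicharacter F Γ) (d : Fin m → Γ) (μ : Fin m → F) :
    IsColorMatrixUnits ε d (fockUnit ε d μ) := (isColorWeyl_fock ε d μ).isColorMatrixUnits

theorem fockUnit_diag_apply (ε : Bicharacter F Γ) (d : Fin m → Γ) (μ : Fin m → F) (i : Fin m)
    (f : Fock F m) (n : Fin m ×ₗ Fin m → ℤ) : fockUnit ε d μ i i f n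
      = (μ i + (∑ a, numberValue ε d i a (n (toLex (i, a))) : ℤ)) * f n := by
  have h : ∀ a, (create ε d μ i a * annihilate ε d i a) f n
      = ((if i = a then μ i else 0) + numberValue ε d i a (n (toLex (i, a)))) * f n := by
    intro a
    rw [← createCoeff_mul_annihilateCoeff]
    have := siteOp_mul_self_apply ε (siteDegree d) (toLex (i, a)) (-1) (createCoeff ε d μ i a)
      (annihilateCoeff ε d i a) f n
    rwa [neg_neg] at this
  rw [fockUnit, schwinger, LinearMap.sum_apply, Finset.sum_apply]
  simp only [h]
  rw [← Finset.sum_mul, Finset.sum_add_distrib]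
  simp

theorem single_one_pow_prime {p : ℕ} [hp : Fact p.Prime] (i : Fin m) :
    (Pi.single i 1 : Fin m → F) ^ p = Pi.single i 1 := by
  ext a
  rw [Pi.pow_apply, Pi.single_apply]
  split_ifs <;> simp [hp.out.ne_zero]

variable {p : ℕ} [hp : Fact p.Prime] [CharP F p]

theorem intCast_pow_prime (n : ℤ) : (n : F) ^ p = n := by
  have := map_intCast (frobenius F p) n
  rwa [frobenius_def] at this

/-- The operator is diagonal with eigenvalues in `μ i + ℤ`, and `t ^ p - t` is unchanged by adding
an integer to `t`. -/
theorem fockUnit_diag_pow (ε : Bicharacter F Γ) (d : Fin m → Γ) (μ : Fin m → F) (i : Fin m) :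
    fockUnit ε d μ i i ^ p - fockUnit ε d μ i i
      = algebraMap F (Module.End F (Fock F m)) (μ i ^ p - μ i) := by
  have hpow : ∀ (k : ℕ) (f : Fock F m) n, (fockUnit ε d μ i i ^ k) f n
      = (μ i + (∑ a, numberValue ε d i a (n (toLex (i, a))) : ℤ)) ^ k * f n := by
    intro k f n
    induction k with
    | zero => simp
    | succ k ih => rw [pow_succ', Module.End.mul_apply, fockUnit_diag_apply, ih]; ring
  refine LinearMap.ext fun f => funext fun n => ?_
  rw [LinearMap.sub_apply, Pi.sub_apply, hpow, fockUnit_diag_apply, add_pow_char,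
    intCast_pow_prime, Module.algebraMap_end_apply, Pi.smul_apply, smul_eq_mul]
  ring

theorem exists_lt_intCast_add_mul_eq_zero (e : ℤ) (he : e = 1 ∨ e = -1) (a : ℤ) :
    ∃ r : ℕ, r < p ∧ ((a + r * e : ℤ) : F) = 0 := by
  have hpos : (0 : ℤ) < p := by exact_mod_cast hp.out.pos
  have hne : (p : ℤ) ≠ 0 := hpos.ne'
  -- Since `e * e = 1`, the residue of `-e * a` solves `a + r * e ≡ 0` modulo `p`.
  refine ⟨((-e * a) % p).toNat, ?_, ?_⟩
  · have := Int.emod_lt_of_pos (-e * a) hpos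
    have := Int.emod_nonneg (-e * a) hne
    omega
  · rw [Int.toNat_of_nonneg (Int.emod_nonneg _ hne), CharP.intCast_eq_zero_iff F p,
      Int.emod_def]
    refine ⟨-e * (-e * a / p), ?_⟩
    rcases he with rfl | rfl <;> ring

theorem create_pow_eq_zero (ε : Bicharacter F Γ) (d : Fin m → Γ) (μ : Fin m → F) {i a : Fin m}
    (hia : i ≠ a) : create ε d μ i a ^ p = 0 := by
  refine siteOp_pow_eq_zero _ _ _ fun k => ?_
  by_cases he : ε.IsEven (d i - d a)
  · simp only [createCoeff, if_neg hia, if_pos he]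
    exact exists_lt_intCast_add_mul_eq_zero (-1) (Or.inr rfl) k
  · simp only [createCoeff, if_neg hia, if_neg he]
    by_cases hk : Odd k
    · refine ⟨1, hp.out.one_lt, if_neg ?_⟩
      rw [Int.not_odd_iff_even]
      simpa [← sub_eq_add_neg] using hk.sub_odd odd_one
    · exact ⟨0, hp.out.pos, by simp [hk]⟩

theorem annihilate_pow_eq_zero (ε : Bicharacter F Γ) (d : Fin m → Γ) {i a : Fin m}
    (hia : i ≠ a) (he : ε.IsEven (d i - d a)) : annihilate ε d i a ^ p = 0 := by
  refine siteOp_pow_eq_zero _ _ _ fun k => ?_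
  obtain ⟨r, hr, h0⟩ := exists_lt_intCast_add_mul_eq_zero (F := F) (p := p) 1 (Or.inl rfl) (k + 1)
  refine ⟨r, hr, ?_⟩
  rw [annihilateCoeff, if_neg hia, if_pos he, if_pos]
  rw [← h0]
  push_cast; ring

theorem fockUnit_pow_eq_zero (ε : Bicharacter F Γ) (d : Fin m → Γ) (μ : Fin m → F) {i j : Fin m}
    (hij : i ≠ j) (heven : ε.IsEven (d i - d j)) : fockUnit ε d μ i j ^ p = 0 := by
  have : CharP (Module.End F (Fock F m)) p :=
    charP_of_injective_algebraMap (algebraMap F (Module.End F (Fock F m))).injective p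
  refine (isColorWeyl_fock ε d μ).schwinger_pow_eq_zero hij heven
    (fun a ha => create_pow_eq_zero ε d μ ha) (annihilate_pow_eq_zero ε d hij.symm ?_)
  rw [← neg_sub, ε.isEven_neg]
  exact heven

/-- The state that is annihilated by the raising operators. -/
def topState (m : ℕ) (s : Fin m ×ₗ Fin m) : ℤ := if (ofLex s).1 < (ofLex s).2 then -1 else 0

open Classical in
/-- The highest weight vector of the Fock space. -/
def topVector (F : Type*) [Field F] (m : ℕ) : Fock F m := Pi.single (topState m) 1

theorem topVector_ne_zero : topVector F m ≠ 0 := by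
  classical
  intro h
  have := congrFun h (topState m)
  simp [topVector] at this

theorem fockUnit_topVector (ε : Bicharacter F Γ) (d : Fin m → Γ) (μ : Fin m → F) {i j : Fin m}
    (hij : i < j) : fockUnit ε d μ i j (topVector F m) = 0 := by
  classical
  rw [fockUnit, schwinger, LinearMap.sum_apply]
  refine Finset.sum_eq_zero fun a _ => ?_
  -- In the term `X i a * D j a`, either `i < a` and `X i a`, color-commuted to the right, kills the
  -- state by leading from occupation `-1` to `0`, or `a ≤ i < j` and `D j a` kills it by leading
  -- from `0` to `-1`.
  by_cases ha : i < a
  · have hX : create ε d μ i a (topVector F m) = 0 := by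
      refine siteOp_single_eq_zero _ _ _ ?_
      simp [topState, ha, createCoeff, ha.ne]
    have h := (isColorWeyl_fock ε d μ).mixed j a i a
    rw [if_neg fun h' => hij.ne' h'.1, add_zero] at h
    have h' := congrArg (fun T => T (topVector F m)) h
    simp only [Module.End.mul_apply, LinearMap.smul_apply, hX, map_zero] at h'
    exact (smul_eq_zero.mp h'.symm).resolve_left (ε.val_ne_zero _ _)
  · have haj : a < j := (not_lt.mp ha).trans_lt hij
    have hD : annihilate ε d j a (topVector F m) = 0 := by
      refine siteOp_single_eq_zero _ _ _ ?_
      simp [topState, haj.not_gt, annihilateCoeff, haj.ne']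
    rw [Module.End.mul_apply, hD, map_zero]

theorem fockUnit_diag_topVector (ε : Bicharacter F Γ) (d : Fin m → Γ) (μ : Fin m → F)
    (i : Fin m) : fockUnit ε d μ i i (topVector F m)
      = (μ i + (∑ a, numberValue ε d i a (topState m (toLex (i, a))) : ℤ)) • topVector F m := by
  classical
  ext n
  rw [fockUnit_diag_apply, Pi.smul_apply, smul_eq_mul]
  by_cases hn : n = topState m
  · rw [hn]
  · rw [topVector, Pi.single_eq_of_ne hn, mul_zero, mul_zero]

/-- For every weight `wt` there is a representation of `u_χ(gl(m, Γ))` with a nonzero highest weight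
vector of weight `wt`. -/
theorem exists_highestWeight_representation (ε : Bicharacter F Γ) (d : Fin m → Γ) (hodd : Odd p)
    {χ : Module.Dual F (Matrix (Fin m) (Fin m) F)} (hχ : IsStandardSemisimple d χ)
    {wt : Module.Dual F (Fin m → F)} (hwt : IsWeight p χ wt) :
    ∃ (ρ : RedEnv (gl ε d p) χ →ₐ[F] Module.End F (Fock F m)) (v : Fock F m), v ≠ 0 ∧
      ∀ b : (borel ε d p).carrier,
        ρ (redι (gl ε d p) χ ⟨b.1, trivial⟩) v = wt b.1.diag • v := by
  set N : Fin m → ℤ := fun i => ∑ a, numberValue ε d i a (topState m (toLex (i, a))) with hN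
  set lam : Fin m → F := fun i => wt (Pi.single i 1) with hlam
  -- The number operators add the integer `N i` to the weight of the top state, and `μ` compensates.
  -- The `p`-relation is unaffected, since `N i ^ p = N i` in `F`.
  set μ : Fin m → F := fun i => lam i - N i with hμ
  have hE := isColorMatrixUnits_fock ε d μ
  have hweight : ∀ i, lam i ^ p - lam i = χ (Matrix.single i i 1) ^ p := by
    intro i
    have h := hwt (Pi.single i 1)
    rwa [single_one_pow_prime, Matrix.diagonal_single] at h
  have hpow : ∀ i j, ε.IsEven (d i - d j) →
      fockUnit ε d μ i j ^ p - (if i = j then fockUnit ε d μ i j else 0)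
        = algebraMap F (Module.End F (Fock F m)) (χ (Matrix.single i j 1) ^ p) := by
    intro i j heven
    by_cases hij : i = j
    · subst hij
      rw [if_pos rfl, fockUnit_diag_pow, ← hweight]
      congr 1
      simp only [hμ]
      rw [sub_pow_char, intCast_pow_prime]
      ring
    · have h0 : χ (Matrix.single i j 1) = 0 := by
        rcases lt_or_gt_of_ne hij with h | h
        exacts [hχ.nil_pos i j h, hχ.nil_neg i j h]
      rw [if_neg hij, fockUnit_pow_eq_zero ε d μ hij heven, h0, zero_pow hp.out.ne_zero, map_zero,
        sub_zero]
  refine ⟨redLift (gl ε d p) χ (ofUnits F (fockUnit ε d μ) ∘ₗ (gl ε d p).carrier.subtype)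
    (fun α β x y hx hy => hE.ofUnits_bracket hx hy)
    (fun α x hα hx => hE.ofUnits_pow hodd hpow hα hx), topVector F m, topVector_ne_zero, ?_⟩
  intro b
  refine (congrArg (fun T : Module.End F (Fock F m) => T (topVector F m))
    (redLift_ι _ _ _ _ _ _)).trans ?_
  change ofUnits F (fockUnit ε d μ) b.1 (topVector F m) = wt b.1.diag • topVector F m
  have hdiag : wt b.1.diag = ∑ i, b.1 i i * lam i := by
    have h1 : b.1.diag = ∑ i, b.1 i i • (Pi.single i 1 : Fin m → F) := by
      ext j
      simp [Finset.sum_apply, Pi.single_apply]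
    rw [h1, map_sum]
    simp [hlam]
  change (∑ i, ∑ j, b.1 i j • fockUnit ε d μ i j) (topVector F m) = _
  rw [hdiag, Finset.sum_smul, LinearMap.sum_apply]
  refine Finset.sum_congr rfl fun i _ => ?_
  rw [LinearMap.sum_apply, Finset.sum_eq_single i]
  · rw [LinearMap.smul_apply, fockUnit_diag_topVector, smul_smul]
    simp only [hμ, hN]
    rw [sub_add_cancel]
  · intro j _ hj
    rw [LinearMap.smul_apply]
    rcases lt_or_gt_of_ne hj with h | h
    · rw [b.2 i j h, zero_smul]
    · rw [fockUnit_topVector ε d μ h, smul_zero]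
  · simp

end Model

/-! ### Baby Verma modules of regular semisimple characters -/

section BabyVermaSimple

variable {F : Type*} [Field F] {Γ : Type*} [AddCommGroup Γ] {m : ℕ}
variable {ε : Bicharacter F Γ} {d : Fin m → Γ} {p : ℕ}

theorem adjoin_range_redι (S : RestrictedSubalgebra ε d p)
    (χ : Module.Dual F (Matrix (Fin m) (Fin m) F)) :
    Algebra.adjoin F (Set.range (redι S χ)) = ⊤ := by
  let π : TensorAlgebra F S.carrier →ₐ[F] RedEnv S χ :=
    (RingQuot.mkAlgHom F (RedRel S χ)).comp (RingQuot.mkAlgHom F (EnvRel S))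
  have hπ : Function.Surjective π :=
    (RingQuot.mkAlgHom_surjective F _).comp (RingQuot.mkAlgHom_surjective F _)
  have hrange : Set.range (redι S χ) = π '' Set.range (TensorAlgebra.ι F) := by
    rw [← Set.range_comp]; rfl
  rw [hrange, ← AlgHom.map_adjoin, TensorAlgebra.adjoin_range_ι, Algebra.map_top,
    (AlgHom.range_eq_top π).mpr hπ]

/-- The matrix units in `u_χ(gl(m, Γ))`. -/
def redUnit (ε : Bicharacter F Γ) (d : Fin m → Γ) (p : ℕ)
    (χ : Module.Dual F (Matrix (Fin m) (Fin m) F)) (i j : Fin m) : RedEnv (gl ε d p) χ :=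
  redι (gl ε d p) χ ⟨Matrix.single i j 1, trivial⟩

theorem adjoin_redUnit (χ : Module.Dual F (Matrix (Fin m) (Fin m) F)) :
    Algebra.adjoin F {a | ∃ i j, a = redUnit ε d p χ i j} = ⊤ := by
  rw [eq_top_iff, ← adjoin_range_redι, Algebra.adjoin_le_iff]
  rintro _ ⟨x, rfl⟩
  let e : Fin m → Fin m → (gl ε d p).carrier := fun i j => ⟨Matrix.single i j 1, trivial⟩
  have hx : x = ∑ i, ∑ j, x.1 i j • e i j := by
    apply Subtype.ext
    conv_lhs => rw [Matrix.matrix_eq_sum_single x.1]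
    simp [e]
  rw [hx]
  simp only [map_sum, map_smul]
  refine sum_mem fun i _ => sum_mem fun j _ => Subalgebra.smul_mem _ ?_ _
  exact Algebra.subset_adjoin ⟨i, j, rfl⟩

theorem isColorMatrixUnits_redUnit (χ : Module.Dual F (Matrix (Fin m) (Fin m) F)) :
    IsColorMatrixUnits ε d (redUnit ε d p χ) := by
  intro i j k l
  have hmem : ∀ i j : Fin m, (Matrix.single i j 1 : Matrix (Fin m) (Fin m) F)
      ∈ glGr d (d i - d j) := fun i j => single_mem_glGr (by abel) 1
  have h := redι_bracket (gl ε d p) χ (d i - d j) (d k - d l)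
    ⟨Matrix.single i j 1, trivial⟩ ⟨Matrix.single k l 1, trivial⟩ (hmem i j) (hmem k l)
  have hmul : ∀ i j k l : Fin m, redι (gl ε d p) χ
      ⟨(Matrix.single i j 1 * Matrix.single k l 1 : Matrix (Fin m) (Fin m) F), trivial⟩
        = if j = k then redUnit ε d p χ i l else 0 := by
    intro i j k l
    split_ifs with h
    · subst h
      simp only [Matrix.single_mul_single_same, mul_one]
      rfl
    · simp only [Matrix.single_mul_single_of_ne _ _ _ _ h]
      exact map_zero _
  have hbr : redι (gl ε d p) χ ⟨colorBracket ε (d i - d j) (d k - d l) (Matrix.single i j 1)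
      (Matrix.single k l 1), trivial⟩ = (if j = k then redUnit ε d p χ i l else 0)
        - ε.val (d i - d j) (d k - d l) • (if l = i then redUnit ε d p χ k j else 0) := by
    rw [← hmul, ← hmul, ← map_smul, ← map_sub]
    rfl
  rw [← hbr]
  exact sub_eq_iff_eq_add'.mp h

/-- In even degree this is the `p`-relation, as both `e_ij ^ p` and `χ(e_ij)` vanish. In odd degree
the bracket of `e_ij` with itself gives `2 e_ij² = 0`, and `2` is invertible. -/
theorem redUnit_pow_eq_zero [hp : Fact p.Prime] [CharP F p] (hp3 : 3 < p)
    {χ : Module.Dual F (Matrix (Fin m) (Fin m) F)} (hχ : IsStandardSemisimple d χ) {i j : Fin m}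
    (hij : i ≠ j) : redUnit ε d p χ i j ^ (topExp ε p (d i - d j) + 1) = 0 := by
  rw [topExp]
  split_ifs with heven
  · rw [Nat.sub_add_cancel hp.out.one_le]
    have h := redι_pow (gl ε d p) χ (d i - d j) ⟨Matrix.single i j 1, trivial⟩ heven
      (single_mem_glGr (by abel) 1)
    have h0 : χ (Matrix.single i j 1) = 0 := by
      rcases lt_or_gt_of_ne hij with h | h
      exacts [hχ.nil_pos i j h, hχ.nil_neg i j h]
    rw [h0, zero_pow hp.out.ne_zero, map_zero, sub_eq_zero] at h
    rw [redUnit, h]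
    simp only [single_one_pow hp.out.one_lt, if_neg hij]
    exact map_zero _
  · have h := isColorMatrixUnits_redUnit (ε := ε) (d := d) (p := p) χ i j i j
    rw [if_neg hij.symm, ε.val_self_of_not_isEven heven, smul_zero, sub_zero, add_zero,
      neg_one_smul, eq_neg_iff_add_eq_zero, ← two_smul F] at h
    have h2 : (2 : F) ≠ 0 := by
      have := (CharP.cast_eq_zero_iff F p 2).not.mpr
        (Nat.not_dvd_of_pos_of_lt two_pos (by omega))
      exact_mod_cast this
    rw [pow_two]
    exact (smul_eq_zero_iff_right h2).mp h

/-- Weights of a regular semisimple character are not integral on coroots. -/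
theorem IsRegularSemisimple.apply_coroot_ne_intCast [hp : Fact p.Prime] [CharP F p]
    {χ : Module.Dual F (Matrix (Fin m) (Fin m) F)} (hχ : IsRegularSemisimple ε d χ)
    {wt : Module.Dual F (Fin m → F)} (hwt : IsWeight p χ wt) {i j : Fin m} (hij : i < j)
    {h : Fin m → F} (hh : h ^ p = h) (hdiag : Matrix.diagonal h = corootH ε d i j) (n : ℤ) :
    wt h ≠ n := by
  intro hn
  -- As `h ^ p = h`, the weight condition reads `wt h ^ p - wt h = χ(H_δ) ^ p`; an integral value
  -- would make the left side zero.
  have h1 := hwt h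
  rw [hh, hn, intCast_pow_prime, sub_self, hdiag] at h1
  exact hχ.regular i j hij (pow_eq_zero_iff hp.out.ne_zero |>.mp h1.symm)

/-- A highest weight vector in any representation receives a `u_χ(B)`-map from the inducing line. It
is enough to compare the two actions on the generators of `u_χ(B)`. -/
theorem weightModule_one_smul {χ : Module.Dual F (Matrix (Fin m) (Fin m) F)}
    (hχ : IsStandardSemisimple d χ) {wt : Module.Dual F (Fin m → F)} (hwt : IsWeight p χ wt)
    {M : Type*} [AddCommGroup M] [Module F M]
    (ρ : RedEnv (gl ε d p) χ →ₐ[F] Module.End F M) {v : M}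
    (hv : ∀ b : (borel ε d p).carrier,
      ρ (redι (gl ε d p) χ ⟨b.1, trivial⟩) v = wt b.1.diag • v)
    (b : RedEnv (borel ε d p) χ) (c : F) :
    ρ (redIncl (borel ε d p) χ b) (c • v) = weightModule ε d p hχ hwt b c • v := by
  have hb : b ∈ Algebra.adjoin F (Set.range (redι (borel ε d p) χ)) := by
    rw [adjoin_range_redι]; trivial
  induction hb using Algebra.adjoin_induction generalizing c with
  | mem b hb =>
    obtain ⟨b, rfl⟩ := hb
    rw [redIncl_ι, weightModule_ι, map_smul, hv, smul_smul, mul_comm]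
  | algebraMap r =>
    rw [AlgHom.commutes, AlgHom.commutes, AlgHom.commutes, Module.algebraMap_end_apply,
      Module.algebraMap_end_apply, smul_assoc]
  | add x y _ _ hx hy =>
    rw [map_add, map_add, map_add, LinearMap.add_apply, LinearMap.add_apply, hx, hy, add_smul]
  | mul x y _ _ hx hy =>
    rw [map_mul, map_mul, map_mul, Module.End.mul_apply, Module.End.mul_apply, hy, hx]

/-- The induced module is nonzero as soon as the inducing vector can be realized in some
representation. -/
theorem Induced.tmul_one_ne_zero {A B : Type*} [Ring A] [Algebra F A] [Ring B] [Algebra F B]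
    {φ : B →ₐ[F] A} {σ : B →ₐ[F] Module.End F F} {M : Type*} [AddCommGroup M] [Module F M]
    (ρ : A →ₐ[F] Module.End F M) {v : M} (hv0 : v ≠ 0)
    (hv : ∀ (b : B) (c : F), ρ (φ b) (c • v) = σ b c • v) : Induced.tmul φ σ 1 1 ≠ 0 := by
  -- This is the map of Frobenius reciprocity, `a ⊗ c ↦ ρ a (c • v)`. It kills the relations of the
  -- induced module and sends `1 ⊗ 1` to `v ≠ 0`.
  let Φ : A ⊗[F] F →ₗ[F] M := TensorProduct.lift
    { toFun := fun a => (ρ a) ∘ₗ LinearMap.toSpanSingleton F M v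
      map_add' := fun a b => by ext; simp
      map_smul' := fun r a => by ext; simp }
  have hΦt : ∀ a c, Φ (a ⊗ₜ c) = ρ a (c • v) := fun a c => rfl
  have hΦs : ∀ (a : A) t, Φ (a • t) = ρ a (Φ t) := by
    intro a t
    induction t using TensorProduct.induction_on with
    | zero => simp
    | tmul b c => rw [TensorProduct.smul_tmul', hΦt, hΦt, smul_eq_mul, map_mul]; rfl
    | add x y hx hy => rw [smul_add, map_add, map_add, hx, hy, map_add]
  have hker : ∀ t ∈ inducedRel φ σ, Φ t = 0 := by
    intro t ht
    induction ht using Submodule.span_induction with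
    | mem t ht =>
      obtain ⟨a, b, c, rfl⟩ := ht
      rw [map_sub, hΦt, hΦt, map_mul, Module.End.mul_apply, hv, sub_self]
    | zero => exact map_zero _
    | add x y _ _ hx hy => rw [map_add, hx, hy, add_zero]
    | smul a x _ hx => rw [hΦs, hx, map_zero]
  intro h
  have h1 := hker _ ((Submodule.Quotient.mk_eq_zero _).mp h)
  rw [hΦt, map_one, one_smul] at h1
  exact hv0 h1

theorem Induced.exists_smul_tmul_one {A B : Type*} [Ring A] [Algebra F A] [Ring B] [Algebra F B]
    (φ : B →ₐ[F] A) (σ : B →ₐ[F] Module.End F F) (z : Induced φ σ) :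
    ∃ a : A, a • Induced.tmul φ σ 1 1 = z := by
  obtain ⟨t, rfl⟩ := Submodule.Quotient.mk_surjective _ z
  induction t using TensorProduct.induction_on with
  | zero => exact ⟨0, by rw [zero_smul]; rfl⟩
  | tmul a c =>
    refine ⟨c • a, ?_⟩
    rw [Induced.tmul, ← Submodule.Quotient.mk_smul, TensorProduct.smul_tmul', smul_eq_mul, mul_one,
      TensorProduct.smul_tmul, smul_eq_mul, mul_one]
  | add x y hx hy =>
    obtain ⟨a, ha⟩ := hx
    obtain ⟨b, hb⟩ := hy
    exact ⟨a + b, by rw [add_smul, ha, hb]; rfl⟩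

theorem Induced.smul_tmul_one {A B : Type*} [Ring A] [Algebra F A] [Ring B] [Algebra F B]
    (φ : B →ₐ[F] A) (σ : B →ₐ[F] Module.End F F) (b : B) :
    φ b • Induced.tmul φ σ 1 1 = σ b 1 • Induced.tmul φ σ 1 1 := by
  have h : (φ b) ⊗ₜ[F] (1 : F) - (1 : A) ⊗ₜ[F] (σ b 1) ∈ inducedRel φ σ :=
    Submodule.subset_span ⟨1, b, 1, by rw [one_mul]⟩
  have h1 := (Submodule.Quotient.eq (inducedRel φ σ)).mpr h
  rw [Induced.tmul, ← Submodule.Quotient.mk_smul, TensorProduct.smul_tmul', smul_eq_mul, mul_one,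
    h1, ← Submodule.Quotient.mk_smul, ← TensorProduct.tmul_smul, smul_eq_mul, mul_one]

/-- The generator of a baby Verma module of a regular semisimple character is a regular highest
weight vector. -/
theorem isRegularHighestWeight_babyVerma [hp : Fact p.Prime] [CharP F p] (hp3 : 3 < p)
    {χ : Module.Dual F (Matrix (Fin m) (Fin m) F)} (hχ : IsRegularSemisimple ε d χ)
    {wt : Module.Dual F (Fin m → F)} (hwt : IsWeight p χ wt) :
    IsRegularHighestWeight ε d p (redUnit ε d p χ) (fun i => wt (Pi.single i 1))
      (Induced.tmul (redIncl (borel ε d p) χ)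
        (weightModule ε d p hχ.standardSemisimple hwt) 1 1) := by
  have hact : ∀ i j, i ≤ j → redUnit ε d p χ i j • Induced.tmul (redIncl (borel ε d p) χ)
        (weightModule ε d p hχ.standardSemisimple hwt) 1 1
      = wt (Matrix.single i j 1).diag • Induced.tmul (redIncl (borel ε d p) χ)
        (weightModule ε d p hχ.standardSemisimple hwt) 1 1 := by
    intro i j hij
    have hmem : Matrix.single i j 1 ∈ (borel ε d p).carrier := by
      intro a b hab
      refine Matrix.single_apply_of_ne _ _ _ _ _ ?_
      rintro ⟨rfl, rfl⟩
      exact absurd hab hij.not_gt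
    have h := Induced.smul_tmul_one (redIncl (borel ε d p) χ)
      (weightModule ε d p hχ.standardSemisimple hwt) (redι (borel ε d p) χ ⟨_, hmem⟩)
    rwa [redIncl_ι, weightModule_ι, mul_one] at h
  refine ⟨fun i j hij => redUnit_pow_eq_zero hp3 hχ.standardSemisimple hij, fun i j hij => ?_,
    fun i => ?_, fun i j hij heven n => ?_, fun i j hij heven n => ?_⟩
  · rw [hact i j hij.le, show (Matrix.single i j (1 : F)).diag = 0 from ?_, map_zero, zero_smul]
    ext a
    exact Matrix.single_apply_of_ne _ _ _ _ _ fun h => hij.ne (h.1.trans h.2.symm)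
  · rw [hact i i le_rfl]
    congr 2
    ext a
    simp [Pi.single_apply, eq_comm]
  · rw [← map_sub]
    refine hχ.apply_coroot_ne_intCast hwt hij ?_ ?_ n
    · ext a
      have h1 : ∀ x : Fin m, (Pi.single x 1 : Fin m → F) a ^ p = (Pi.single x 1 : Fin m → F) a :=
        fun x => congrFun (single_one_pow_prime x) a
      rw [Pi.pow_apply, Pi.sub_apply, sub_pow_char, h1, h1]
    · rw [corootH, if_pos heven, ← Matrix.diagonal_single, ← Matrix.diagonal_single,
        Matrix.diagonal_sub]
      rfl
  · rw [← map_add]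
    refine hχ.apply_coroot_ne_intCast hwt hij ?_ ?_ n
    · ext a
      have h1 : ∀ x : Fin m, (Pi.single x 1 : Fin m → F) a ^ p = (Pi.single x 1 : Fin m → F) a :=
        fun x => congrFun (single_one_pow_prime x) a
      rw [Pi.pow_apply, Pi.add_apply, add_pow_char, h1, h1]
    · rw [corootH, if_neg heven, ← Matrix.diagonal_single, ← Matrix.diagonal_single,
        Matrix.diagonal_add]
      rfl

end BabyVermaSimple

end ColorLie

end

theorem corollary4p4 {F : Type*} [Field F] [IsAlgClosed F] (p : ℕ) [Fact p.Prime] [CharP F p]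
    (hp : 3 < p) {Γ : Type*} [AddCommGroup Γ] [Finite Γ] (ε : ColorLie.Bicharacter F Γ)
    (m : ℕ) (d : Fin m → Γ)
    (χ : Module.Dual F (Matrix (Fin m) (Fin m) F))
    (hχ : ColorLie.IsRegularSemisimple ε d χ)
    (wt : Module.Dual F (Fin m → F)) (hwt : ColorLie.IsWeight p χ wt) (γ₀ : Γ) :
    ColorLie.IsGradedSimple (ColorLie.RedEnv (ColorLie.gl ε d p) χ)
      (ColorLie.BabyVerma.gr ε d p hχ.standardSemisimple hwt γ₀) := by
  have hodd : Odd p := (Fact.out : p.Prime).odd_of_ne_two (by omega)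
  obtain ⟨ρ, v, hv0, hv⟩ := ColorLie.exists_highestWeight_representation (p := p) ε d hodd
    hχ.standardSemisimple hwt
  have hne := ColorLie.Induced.tmul_one_ne_zero ρ hv0
    (ColorLie.weightModule_one_smul hχ.standardSemisimple hwt ρ hv)
  refine ⟨⟨_, 0, hne⟩, fun N _ => ?_⟩
  exact (ColorLie.isRegularHighestWeight_babyVerma hp hχ hwt).eq_bot_or_eq_top
    (ColorLie.isColorMatrixUnits_redUnit χ) (ColorLie.adjoin_redUnit χ)
    (ColorLie.Induced.exists_smul_tmul_one _ _) N
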